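/- Let $N\ge 1$, let $\Omega_1\subset\Omega_2\subset\mathbb{R}^N$ be open sets with $\Omega_2$ bounded, and let $p:\Omega_2\to(1,\infty)$ be measurable with $1<\inf_{\Omega_2}p\le\sup_{\Omega_2}p<\infty$. For an open set $\Omega\subset\Omega_2$, let $L^{p(x)}(\Omega)$ be the space of $g\in L^1_{loc}(\Omega)$ with $\int_\Omega|g|^{p(x)}\,dx<\infty$, and let $W^{1,p(x)}(\Omega)$ be the space of $u\in W^{1,1}_{loc}(\Omega)$ with $u,|\nabla u|\in L^{p(x)}(\Omega)$, with the Luxemburg norm $$\|u\|_{1,p(x)}=\inf\Big\{\lambda>0:\int_\Omega\Big|\frac{u}{\lambda}\Big|^{p(x)}+\Big|\frac{\nabla u}{\lambda}\Big|^{p(x)}dx<1\Big\}.$$ Let $W^{1,p(x)}_0(\Omega)$ be the closure in $W^{1,p(x)}(\Omega)$ of its elements with compact support in $\Omega$, its elements being extended by zero outside $\Omega$, so that $W^{1,p(x)}_0(\Omega_1)\subset W^{1,p(x)}_0(\Omega_2)$, and let $W^{-1,p'(x)}(\Omega)$ be its topological dual. Thus $f\in W^{-1,p'(x)}(\Omega_2)$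 also acts on $W^{1,p(x)}_0(\Omega_1)$. Write $f\ge0$ if $\langle f,v\rangle\ge0$ for every $v\in W^{1,p(x)}_0(\Omega_2)$ with $v\ge0$ a.e. A weak solution of the Dirichlet problem $-\Delta_{p(x)}u=f$ in $\Omega$, $u=0$ on $\partial\Omega$, is a function $u\in W^{1,p(x)}_0(\Omega)$ such that $$\int_\Omega|\nabla u|^{p(x)-2}\nabla u\cdot\nabla v\,dx=\langle f,v\rangle\qquad\text{for every }v\in W^{1,p(x)}_0(\Omega);$$ it is denoted by $u^f_\Omega$. Proposition (monotonicity with respect to the domain). Let $f\in W^{-1,p'(x)}(\Omega_2)$ with $f\ge0$, and let $u^f_{\Omega_1}$ and $u^f_{\Omega_2}$ be weak solutions of the Dirichlet problem in $\Omega_1$ and in $\Omega_2$, respectively. Then $u^f_{\Omega_1}\le u^f_{\Omega_2}$ a.e. in $\Omega_2$. -/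

import Mathlib

open MeasureTheory
open scoped ENNReal ContDiff

noncomputable section

namespace VarExp

/-- Euclidean space `ℝ^N`. -/
abbrev E (N : ℕ) : Type := EuclideanSpace ℝ (Fin N)

variable {N : ℕ}

/-- The exponents `p : Ω → [1, ∞)` that are measurable and bounded. A function on `Ω` is given
by a function on `ℝ^N` of which only the values on `Ω` are used. -/
structure IsExponent (p : E N → ℝ) (Ω : Set (E N)) : Prop where
  measurable : Measurable (Ω.domRestrict p)
  one_le : ∀ x ∈ Ω, 1 ≤ p x
  bounded : ∃ P : ℝ, ∀ x ∈ Ω, p x ≤ P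

/-- The modular `∫_Ω |g(x)|^{p(x)} dx`, for scalar or vector valued `g`. -/
def modular {F : Type*} [NormedAddCommGroup F] (p : E N → ℝ) (Ω : Set (E N)) (g : E N → F) :
    ℝ≥0∞ :=
  ∫⁻ x in Ω, ‖g x‖ₑ ^ p x

/-- `g ∈ L^{p(x)}(Ω)`: `g` is locally integrable on `Ω` and has finite modular. -/
def MemLebesgue {F : Type*} [NormedAddCommGroup F] (p : E N → ℝ) (Ω : Set (E N))
    (g : E N → F) : Prop :=
  LocallyIntegrableOn g Ω ∧ modular p Ω g < ⊤

/-- `φ ∈ C_c^∞(Ω)`. -/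
def IsTestFunction (Ω : Set (E N)) (φ : E N → ℝ) : Prop :=
  ContDiff ℝ ∞ φ ∧ HasCompactSupport φ ∧ tsupport φ ⊆ Ω

/-- `u, G ∈ L^1_loc(Ω)` and `G` is a weak gradient of `u` in `Ω`. -/
def IsWeakGradient (Ω : Set (E N)) (u : E N → ℝ) (G : E N → E N) : Prop :=
  LocallyIntegrableOn u Ω ∧ LocallyIntegrableOn G Ω ∧
    ∀ φ : E N → ℝ, IsTestFunction Ω φ → ∀ i : Fin N,
      ∫ x in Ω, u x * fderiv ℝ φ x (EuclideanSpace.single i 1) = -∫ x in Ω, G x i * φ x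

open Classical in
/-- The weak gradient of `u` in `Ω`, determined a.e. in `Ω` for `u ∈ W^{1,1}_loc(Ω)`
(and `0` for every other function). -/
def weakGrad (Ω : Set (E N)) (u : E N → ℝ) : E N → E N :=
  if h : ∃ G, IsWeakGradient Ω u G then h.choose else 0

/-- `u ∈ W^{1,p(x)}(Ω)`. -/
def MemSobolev (p : E N → ℝ) (Ω : Set (E N)) (u : E N → ℝ) : Prop :=
  (∃ G, IsWeakGradient Ω u G) ∧ MemLebesgue p Ω u ∧ MemLebesgue p Ω (weakGrad Ω u)

/-- The modular `∫_Ω |u|^{p(x)} + |∇u|^{p(x)} dx` of `W^{1,p(x)}(Ω)`. -/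
def sobolevModular (p : E N → ℝ) (Ω : Set (E N)) (u : E N → ℝ) : ℝ≥0∞ :=
  modular p Ω u + modular p Ω (weakGrad Ω u)

/-- The Luxemburg norm of `W^{1,p(x)}(Ω)`. -/
def sobolevNorm (p : E N → ℝ) (Ω : Set (E N)) (u : E N → ℝ) : ℝ :=
  sInf {l : ℝ | 0 < l ∧ sobolevModular p Ω (l⁻¹ • u) < 1}

/-- `u ∈ W_0^{1,p(x)}(Ω)`: `u` is in the closure, in `W^{1,p(x)}(Ω)`, of the functions of
`W^{1,p(x)}(Ω)` with compact support in `Ω`. Elements of this space are extended by `0` outside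
`Ω`, so that `W_0^{1,p(x)}(Ω₁) ⊆ W_0^{1,p(x)}(Ω₂)` for open sets `Ω₁ ⊆ Ω₂`. -/
def MemSobolevZero (p : E N → ℝ) (Ω : Set (E N)) (u : E N → ℝ) : Prop :=
  (∀ x ∉ Ω, u x = 0) ∧ MemSobolev p Ω u ∧
    ∀ ε : ℝ, 0 < ε → ∃ φ : E N → ℝ, MemSobolev p Ω φ ∧ HasCompactSupport φ ∧ tsupport φ ⊆ Ω ∧
      sobolevNorm p Ω (u - φ) < ε

/-- `f ∈ W^{-1,p'(x)}(Ω)`: `f` is a bounded linear functional on `W_0^{1,p(x)}(Ω)`. Its values at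
functions outside `W_0^{1,p(x)}(Ω)` play no role. -/
structure IsDualElement (p : E N → ℝ) (Ω : Set (E N)) (f : (E N → ℝ) → ℝ) : Prop where
  map_add : ∀ u v, MemSobolevZero p Ω u → MemSobolevZero p Ω v → f (u + v) = f u + f v
  map_smul : ∀ (c : ℝ) (u), MemSobolevZero p Ω u → f (c • u) = c * f u
  bounded : ∃ C : ℝ, ∀ u, MemSobolevZero p Ω u → |f u| ≤ C * sobolevNorm p Ω u

/-- `f ≥ 0` in `W^{-1,p'(x)}(Ω)`. -/
def IsNonnegFunctional (p : E N → ℝ) (Ω : Set (E N)) (f : (E N → ℝ) → ℝ) : Prop :=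
  ∀ v, MemSobolevZero p Ω v → (∀ᵐ x ∂(volume.restrict Ω), 0 ≤ v x) → 0 ≤ f v

/-- `u ∈ W_0^{1,p(x)}(Ω)` is the weak solution `u_Ω^f` of `-Δ_{p(x)} u = f` in `Ω`, `u = 0` on
`∂Ω`. The integrand is `0` where `∇u = 0`. -/
def IsWeakSolution (p : E N → ℝ) (Ω : Set (E N)) (f : (E N → ℝ) → ℝ) (u : E N → ℝ) : Prop :=
  MemSobolevZero p Ω u ∧
    ∀ v, MemSobolevZero p Ω v →
      ∫ x in Ω, ‖weakGrad Ω u x‖ ^ (p x - 2) * inner ℝ (weakGrad Ω u x) (weakGrad Ω v x) = f v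

end VarExp

end

namespace VarExp

open Filter Topology
open scoped Convolution

variable {N : ℕ} {Ω Ω' : Set (E N)} {p : E N → ℝ} {u v z : E N → ℝ} {G H V Z : E N → E N}

/-! ### Weak gradients -/

/-! The proof tests both equations with `w = (u₁ - u₂)⁺`. Since `f ≥ 0`, testing the equation on
`Ω₂` with `(-u₂)⁺` gives `u₂ ≥ 0` (`IsWeakSolution.ae_nonneg`). Hence `w`, formed on `Ω₁`, belongs
to `W_0^{1,p(x)}(Ω₁)` even though `u₂` need not vanish on `∂Ω₁` (`MemSobolevZero.posPart_sub`), and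
its extension by zero is admissible on `Ω₂` (`MemSobolevZero.extend`). Both equations then have the
same right hand side `⟨f, w⟩`, so the fluxes of `u₁` and `u₂` have equal integrals against `∇w` over
`Ω₁`. As `∇w` is `∇u₁ - ∇u₂` on `{u₁ > u₂}` and zero elsewhere, strict monotonicity of `a ↦
|a|^{p-2} a` forces `∇w = 0`, hence `w = 0` (`MemSobolevZero.ae_le`). Outside `Ω₁` the claim is `0 ≤
u₂`.

The analytic work is to justify these manipulations for a merely measurable exponent. Mollification
need not converge in `L^{p(x)}`, so it is used only in `L¹`, for the chain rule behind the gradient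
of a positive part. Membership in `W_0^{1,p(x)}` is handled by compactly supported approximations
whose modulars converge; for bounded exponents this is equivalent to convergence in the Luxemburg
norm. No Poincaré inequality is needed: a function with zero gradient in `W_0^{1,p(x)}` is shown to
vanish by translating test functions off the bounded domain. -/

lemma integrableOn_mul_of_tsupport_subset {ψ : E N → ℝ}
    (hu : LocallyIntegrableOn u Ω) (hψ : Continuous ψ) (hc : HasCompactSupport ψ)
    (hs : tsupport ψ ⊆ Ω) : IntegrableOn (fun x => u x * ψ x) Ω := by
  have h1 : IntegrableOn (fun x => u x * ψ x) (tsupport ψ) :=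
    (hu.integrableOn_compact_subset hs hc).mul_continuousOn hψ.continuousOn hc
  have h2 : Integrable (fun x => u x * ψ x) := by
    rw [integrableOn_iff_integrable_of_support_subset] at h1
    · exact h1
    · intro x hx
      exact subset_tsupport ψ (right_ne_zero_of_mul hx)
  exact h2.integrableOn

lemma locallyIntegrableOn_coord (hG : LocallyIntegrableOn G Ω) (i : Fin N) :
    LocallyIntegrableOn (fun x => G x i) Ω := by
  intro x hx
  obtain ⟨s, hs, h⟩ := hG x hx
  exact ⟨s, hs, (EuclideanSpace.proj (𝕜 := ℝ) i).integrable_comp h⟩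

lemma IsTestFunction.continuous_fderiv_apply {φ : E N → ℝ} (hφ : IsTestFunction Ω φ) (v : E N) :
    Continuous (fun x => fderiv ℝ φ x v) :=
  (hφ.1.continuous_fderiv (by simp)).clm_apply continuous_const

lemma tsupport_fderiv_apply_subset_tsupport (φ : E N → ℝ) (v : E N) :
    tsupport (fun x => fderiv ℝ φ x v) ⊆ tsupport φ := by
  refine closure_minimal (fun x hx => ?_) (isClosed_tsupport φ)
  by_contra h
  apply hx
  simp [fderiv_of_notMem_tsupport (𝕜 := ℝ) h]

lemma IsTestFunction.hasCompactSupport_fderiv_apply {φ : E N → ℝ} (hφ : IsTestFunction Ω φ)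
    (v : E N) : HasCompactSupport (fun x => fderiv ℝ φ x v) :=
  hφ.2.1.of_isClosed_subset (isClosed_tsupport _) (tsupport_fderiv_apply_subset_tsupport φ v)

lemma IsTestFunction.integrableOn_mul_fderiv {φ : E N → ℝ} (hφ : IsTestFunction Ω φ)
    (hu : LocallyIntegrableOn u Ω) (v : E N) :
    IntegrableOn (fun x => u x * fderiv ℝ φ x v) Ω :=
  integrableOn_mul_of_tsupport_subset hu (hφ.continuous_fderiv_apply v)
    (hφ.hasCompactSupport_fderiv_apply v) ((tsupport_fderiv_apply_subset_tsupport φ v).trans hφ.2.2)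

lemma IsTestFunction.integrableOn_coord_mul {φ : E N → ℝ} (hφ : IsTestFunction Ω φ)
    (hG : LocallyIntegrableOn G Ω) (i : Fin N) :
    IntegrableOn (fun x => G x i * φ x) Ω :=
  integrableOn_mul_of_tsupport_subset (locallyIntegrableOn_coord hG i) hφ.1.continuous hφ.2.1 hφ.2.2

lemma IsTestFunction.mono {φ : E N → ℝ} (hφ : IsTestFunction Ω' φ) (h : Ω' ⊆ Ω) :
    IsTestFunction Ω φ := ⟨hφ.1, hφ.2.1, hφ.2.2.trans h⟩

/-- Weak gradients are unique almost everywhere. -/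
lemma IsWeakGradient.ae_unique (hΩ : IsOpen Ω) (hu : IsWeakGradient Ω u G)
    (hv : IsWeakGradient Ω v H) (huv : u =ᵐ[volume.restrict Ω] v) :
    G =ᵐ[volume.restrict Ω] H := by
  -- Each coordinate is handled by the fundamental lemma of the calculus of variations.
  have key : ∀ i : Fin N, ∀ᵐ x, x ∈ Ω → G x i - H x i = 0 := by
    intro i
    refine hΩ.ae_eq_zero_of_integral_contDiff_smul_eq_zero
      ((locallyIntegrableOn_coord hu.2.1 i).sub (locallyIntegrableOn_coord hv.2.1 i)) ?_
    intro g hg hgc hgs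
    have ht : IsTestFunction Ω g := ⟨hg, hgc, hgs⟩
    have e1 := hu.2.2 g ht i
    have e2 := hv.2.2 g ht i
    have e3 : ∫ x in Ω, u x * fderiv ℝ g x (EuclideanSpace.single i 1)
        = ∫ x in Ω, v x * fderiv ℝ g x (EuclideanSpace.single i 1) :=
      integral_congr_ae (huv.mono fun x hx => by simp only [hx])
    have e4 : ∫ x in Ω, (G x i * g x - H x i * g x) = 0 := by
      rw [integral_sub (ht.integrableOn_coord_mul hu.2.1 i) (ht.integrableOn_coord_mul hv.2.1 i)]
      linarith
    rw [← e4, ← setIntegral_eq_integral_of_forall_compl_eq_zero (s := Ω)]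
    · exact integral_congr_ae (Eventually.of_forall fun x => by simp only [smul_eq_mul]; ring)
    · intro x hx
      rw [image_eq_zero_of_notMem_tsupport (fun h => hx (hgs h)), zero_smul]
  have h2 := ae_all_iff.2 key
  rw [EventuallyEq, ae_restrict_iff' hΩ.measurableSet]
  filter_upwards [h2] with x hx hxΩ
  ext i
  exact sub_eq_zero.1 (hx i hxΩ)

lemma weakGrad_spec (h : ∃ G, IsWeakGradient Ω u G) : IsWeakGradient Ω u (weakGrad Ω u) := by
  unfold weakGrad
  rw [dif_pos h]
  exact h.choose_spec

lemma IsWeakGradient.weakGrad_ae_eq (hΩ : IsOpen Ω) (h : IsWeakGradient Ω u G) :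
    weakGrad Ω u =ᵐ[volume.restrict Ω] G :=
  (weakGrad_spec ⟨G, h⟩).ae_unique hΩ h EventuallyEq.rfl

lemma locallyIntegrableOn_congr_ae {F : Type*} [NormedAddCommGroup F] {f g : E N → F}
    (hΩ : IsOpen Ω) (hf : LocallyIntegrableOn f Ω) (h : f =ᵐ[volume.restrict Ω] g) :
    LocallyIntegrableOn g Ω := by
  rw [locallyIntegrableOn_iff hΩ.isLocallyClosed] at hf ⊢
  intro k hk hkc
  exact (hf k hk hkc).congr (ae_mono (Measure.restrict_mono hk le_rfl) h)

lemma IsWeakGradient.congr (hΩ : IsOpen Ω) (h : IsWeakGradient Ω u G)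
    (huv : u =ᵐ[volume.restrict Ω] v) (hGH : G =ᵐ[volume.restrict Ω] H) :
    IsWeakGradient Ω v H := by
  refine ⟨locallyIntegrableOn_congr_ae hΩ h.1 huv, locallyIntegrableOn_congr_ae hΩ h.2.1 hGH, fun φ hφ i => ?_⟩
  have e1 : ∫ x in Ω, u x * fderiv ℝ φ x (EuclideanSpace.single i 1)
      = ∫ x in Ω, v x * fderiv ℝ φ x (EuclideanSpace.single i 1) :=
    integral_congr_ae (huv.mono fun x hx => by simp only [hx])
  have e2 : ∫ x in Ω, G x i * φ x = ∫ x in Ω, H x i * φ x :=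
    integral_congr_ae (hGH.mono fun x hx => by simp only [hx])
  rw [← e1, ← e2, h.2.2 φ hφ i]

lemma IsWeakGradient.smul (c : ℝ) (h : IsWeakGradient Ω u G) :
    IsWeakGradient Ω (c • u) (c • G) := by
  refine ⟨h.1.smul c, h.2.1.smul c, fun φ hφ i => ?_⟩
  have := h.2.2 φ hφ i
  simp only [Pi.smul_apply, smul_eq_mul, PiLp.smul_apply, mul_assoc, integral_const_mul, this]
  ring

lemma IsWeakGradient.sub (hu : IsWeakGradient Ω u G) (hv : IsWeakGradient Ω v H) :
    IsWeakGradient Ω (u - v) (G - H) := by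
  refine ⟨hu.1.sub hv.1, hu.2.1.sub hv.2.1, fun φ hφ i => ?_⟩
  have e1 := hu.2.2 φ hφ i
  have e2 := hv.2.2 φ hφ i
  simp only [Pi.sub_apply, PiLp.sub_apply, sub_mul]
  rw [integral_sub (hφ.integrableOn_mul_fderiv hu.1 _) (hφ.integrableOn_mul_fderiv hv.1 _),
    integral_sub (hφ.integrableOn_coord_mul hu.2.1 i) (hφ.integrableOn_coord_mul hv.2.1 i), e1, e2]
  ring

lemma isWeakGradient_zero : IsWeakGradient Ω (0 : E N → ℝ) 0 :=
  ⟨locallyIntegrableOn_zero, locallyIntegrableOn_zero, fun φ hφ i => by simp⟩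

lemma IsWeakGradient.mono (h : IsWeakGradient Ω u G) (hs : Ω' ⊆ Ω) : IsWeakGradient Ω' u G := by
  refine ⟨h.1.mono_set hs, h.2.1.mono_set hs, fun φ hφ i => ?_⟩
  have := h.2.2 φ (hφ.mono hs) i
  have z1 : ∀ x ∉ Ω', u x * fderiv ℝ φ x (EuclideanSpace.single i 1) = 0 := fun x hx => by
    rw [fderiv_of_notMem_tsupport (𝕜 := ℝ) (fun h => hx (hφ.2.2 h))]; simp
  have z2 : ∀ x ∉ Ω', G x i * φ x = 0 := fun x hx => by
    rw [image_eq_zero_of_notMem_tsupport (fun h => hx (hφ.2.2 h)), mul_zero]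
  rw [setIntegral_eq_integral_of_forall_compl_eq_zero z1,
    setIntegral_eq_integral_of_forall_compl_eq_zero z2,
    ← setIntegral_eq_integral_of_forall_compl_eq_zero (s := Ω) fun x hx => z1 x fun h => hx (hs h),
    ← setIntegral_eq_integral_of_forall_compl_eq_zero (s := Ω) fun x hx => z2 x fun h => hx (hs h),
    this]

/-! ### The modular -/

section Modular

variable {F : Type*} [NormedAddCommGroup F] {g h : E N → F}

lemma IsExponent.mono (hp : IsExponent p Ω) (hs : Ω' ⊆ Ω) : IsExponent p Ω' where
  measurable := hp.measurable.comp (measurable_inclusion hs)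
  one_le x hx := hp.one_le x (hs hx)
  bounded := hp.bounded.imp fun _ h x hx => h x (hs hx)

lemma IsExponent.aemeasurable (hp : IsExponent p Ω) (hΩ : IsOpen Ω) :
    AEMeasurable p (volume.restrict Ω) :=
  aemeasurable_restrict_of_measurable_subtype hΩ.measurableSet hp.measurable

lemma IsExponent.aemeasurable_enorm_rpow (hp : IsExponent p Ω) (hΩ : IsOpen Ω)
    (hg : AEStronglyMeasurable g (volume.restrict Ω)) :
    AEMeasurable (fun x => ‖g x‖ₑ ^ p x) (volume.restrict Ω) :=
  hg.enorm.pow (hp.aemeasurable hΩ)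

lemma modular_mono (hp : IsExponent p Ω) (hΩ : IsOpen Ω) {F' : Type*} [NormedAddCommGroup F']
    {k : E N → F'} (hgk : ∀ᵐ x ∂volume.restrict Ω, ‖g x‖ ≤ ‖k x‖) :
    modular p Ω g ≤ modular p Ω k := by
  refine lintegral_mono_ae ?_
  filter_upwards [hgk, ae_restrict_mem hΩ.measurableSet] with x hx hxΩ
  exact ENNReal.rpow_le_rpow (enorm_le_iff_norm_le.2 hx) (zero_le_one.trans (hp.one_le x hxΩ))

lemma modular_congr (hgh : g =ᵐ[volume.restrict Ω] h) : modular p Ω g = modular p Ω h :=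
  lintegral_congr_ae (hgh.mono fun x hx => by simp only [hx])

lemma modular_zero (hp : IsExponent p Ω) (hΩ : IsOpen Ω) :
    modular p Ω (0 : E N → F) = 0 := by
  unfold modular
  rw [setLIntegral_congr_fun hΩ.measurableSet (g := fun _ => 0)]
  · simp
  · intro x hx
    simp [ENNReal.zero_rpow_of_pos (zero_lt_one.trans_le (hp.one_le x hx))]

lemma modular_indicator (hp : IsExponent p Ω') (hΩ : IsOpen Ω) (hΩ' : IsOpen Ω') (hs : Ω ⊆ Ω') :
    modular p Ω' (Ω.indicator g) = modular p Ω g := by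
  unfold modular
  rw [← Set.inter_eq_self_of_subset_left hs, ← Measure.restrict_restrict hΩ.measurableSet,
    ← lintegral_indicator hΩ.measurableSet, Set.inter_eq_self_of_subset_left hs]
  refine setLIntegral_congr_fun hΩ'.measurableSet fun x hx => ?_
  by_cases h : x ∈ Ω
  · simp [h]
  · simp [h, ENNReal.zero_rpow_of_pos (zero_lt_one.trans_le (hp.one_le x hx))]

/-- Convexity of `t ↦ t ^ p x` gives the factor `2 ^ (p x - 1)`, which is at most `2 ^ P`. This
replaces the triangle inequality for the modular. -/
lemma modular_add_le (hp : IsExponent p Ω) (hΩ : IsOpen Ω) {P : ℝ} (hP : ∀ x ∈ Ω, p x ≤ P)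
    (hg : AEStronglyMeasurable g (volume.restrict Ω)) :
    modular p Ω (g + h) ≤ 2 ^ P * (modular p Ω g + modular p Ω h) := by
  unfold modular
  rw [← lintegral_add_left' (hp.aemeasurable_enorm_rpow hΩ hg),
    ← lintegral_const_mul' _ _ (by finiteness)]
  refine setLIntegral_mono' hΩ.measurableSet fun x hx => ?_
  have h1 := hp.one_le x hx
  calc ‖(g + h) x‖ₑ ^ p x ≤ (‖g x‖ₑ + ‖h x‖ₑ) ^ p x :=
        ENNReal.rpow_le_rpow (enorm_add_le _ _) (by linarith)
    _ ≤ 2 ^ (p x - 1) * (‖g x‖ₑ ^ p x + ‖h x‖ₑ ^ p x) :=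
        ENNReal.rpow_add_le_mul_rpow_add_rpow _ _ h1
    _ ≤ 2 ^ P * (‖g x‖ₑ ^ p x + ‖h x‖ₑ ^ p x) := by
        gcongr
        · norm_num
        · linarith [hP x hx]

lemma modular_neg : modular p Ω (-g) = modular p Ω g := by
  simp [modular]

lemma modular_add_lt_top (hp : IsExponent p Ω) (hΩ : IsOpen Ω)
    (hgm : AEStronglyMeasurable g (volume.restrict Ω))
    (hg : modular p Ω g < ⊤) (hh : modular p Ω h < ⊤) : modular p Ω (g + h) < ⊤ := by
  obtain ⟨P, hP⟩ := hp.bounded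
  refine (modular_add_le hp hΩ hP hgm).trans_lt ?_
  finiteness

lemma modular_sub_lt_top (hp : IsExponent p Ω) (hΩ : IsOpen Ω)
    (hgm : AEStronglyMeasurable g (volume.restrict Ω))
    (hg : modular p Ω g < ⊤) (hh : modular p Ω h < ⊤) : modular p Ω (g - h) < ⊤ := by
  rw [sub_eq_add_neg]
  exact modular_add_lt_top hp hΩ hgm hg (by rwa [modular_neg])

lemma modular_smul_le_of_forall [NormedSpace ℝ F] (hp : IsExponent p Ω) (hΩ : IsOpen Ω)
    {c : ℝ} {C : ℝ≥0∞} (hC : C ≠ ⊤) (hc : ∀ x ∈ Ω, ‖c‖ₑ ^ p x ≤ C) :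
    modular p Ω (c • g) ≤ C * modular p Ω g := by
  unfold modular
  rw [← lintegral_const_mul' _ _ hC]
  refine setLIntegral_mono' hΩ.measurableSet fun x hx => ?_
  have h1 := hp.one_le x hx
  rw [Pi.smul_apply, enorm_smul, ENNReal.mul_rpow_of_nonneg _ _ (by linarith)]
  gcongr
  exact hc x hx

/-- Scaling by a factor of absolute value at most `1`. -/
lemma modular_smul_le_of_le_one [NormedSpace ℝ F] (hp : IsExponent p Ω) (hΩ : IsOpen Ω)
    {c : ℝ} (hc : ‖c‖ₑ ≤ 1) : modular p Ω (c • g) ≤ ‖c‖ₑ * modular p Ω g := by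
  refine modular_smul_le_of_forall hp hΩ (by simp) fun x hx => ?_
  simpa using ENNReal.rpow_le_rpow_of_exponent_ge hc (hp.one_le x hx)

/-- Scaling by a factor of absolute value at least `1`. -/
lemma modular_smul_le_of_one_le [NormedSpace ℝ F] (hp : IsExponent p Ω) (hΩ : IsOpen Ω)
    {P : ℝ} (hP0 : 0 ≤ P) (hP : ∀ x ∈ Ω, p x ≤ P) {c : ℝ} (hc : 1 ≤ ‖c‖ₑ) :
    modular p Ω (c • g) ≤ ‖c‖ₑ ^ P * modular p Ω g :=
  modular_smul_le_of_forall hp hΩ (ENNReal.rpow_ne_top_of_nonneg hP0 (by simp))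
    fun x hx => ENNReal.rpow_le_rpow_of_exponent_le hc (hP x hx)

lemma IsExponent.exists_bound (hp : IsExponent p Ω) : ∃ P : ℝ, 0 ≤ P ∧ ∀ x ∈ Ω, p x ≤ P := by
  obtain ⟨P, hP⟩ := hp.bounded
  exact ⟨max P 0, le_max_right _ _, fun x hx => (hP x hx).trans (le_max_left _ _)⟩

lemma modular_smul_lt_top [NormedSpace ℝ F] (hp : IsExponent p Ω) (hΩ : IsOpen Ω) (c : ℝ)
    (hg : modular p Ω g < ⊤) : modular p Ω (c • g) < ⊤ := by
  rcases le_total ‖c‖ₑ 1 with h | h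
  · exact (modular_smul_le_of_le_one hp hΩ h).trans_lt (ENNReal.mul_lt_top (by simp) hg)
  · obtain ⟨P, hP0, hP⟩ := hp.exists_bound
    exact (modular_smul_le_of_one_le hp hΩ hP0 hP h).trans_lt
      (ENNReal.mul_lt_top (ENNReal.rpow_lt_top_of_nonneg hP0 (by simp)) hg)

/-- Pointwise, `t ≤ 1 + t ^ p x`, because `p x ≥ 1`. -/
lemma lintegral_enorm_le_modular (hp : IsExponent p Ω) (hΩ : IsOpen Ω) :
    ∫⁻ x in Ω, ‖g x‖ₑ ≤ volume Ω + modular p Ω g := by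
  calc ∫⁻ x in Ω, ‖g x‖ₑ ≤ ∫⁻ x in Ω, (1 + ‖g x‖ₑ ^ p x) := by
        refine setLIntegral_mono' hΩ.measurableSet fun x hx => ?_
        rcases le_total ‖g x‖ₑ 1 with h | h
        · exact h.trans le_self_add
        · refine le_trans ?_ le_add_self
          simpa using ENNReal.rpow_le_rpow_of_exponent_le h (hp.one_le x hx)
    _ = volume Ω + modular p Ω g := by
        rw [lintegral_add_left measurable_const]
        simp [modular]

lemma integrableOn_of_modular_lt_top (hp : IsExponent p Ω) (hΩ : IsOpen Ω)
    (hb : Bornology.IsBounded Ω) (hg : AEStronglyMeasurable g (volume.restrict Ω))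
    (h : modular p Ω g < ⊤) : IntegrableOn g Ω :=
  ⟨hg, (lintegral_enorm_le_modular hp hΩ).trans_lt (ENNReal.add_lt_top.2 ⟨hb.measure_lt_top, h⟩)⟩

/-- Modular convergence to zero implies convergence to zero in `L¹`. -/
lemma tendsto_lintegral_enorm_of_modular [NormedSpace ℝ F] (hp : IsExponent p Ω) (hΩ : IsOpen Ω)
    (hb : Bornology.IsBounded Ω) {g : ℕ → E N → F}
    (h : Tendsto (fun n => modular p Ω (g n)) atTop (𝓝 0)) :
    Tendsto (fun n => ∫⁻ x in Ω, ‖g n x‖ₑ) atTop (𝓝 0) := by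
  obtain ⟨P, hP0, hP⟩ := hp.exists_bound
  have hV : volume Ω ≠ ⊤ := hb.measure_lt_top.ne
  -- The previous estimate is applied to `(k + 1) • g n` and divided by `k + 1`. This makes the
  -- volume term small for large `k`, after which `n → ∞` removes the modular term.
  have bound : ∀ k n : ℕ, ∫⁻ x in Ω, ‖g n x‖ₑ ≤
      ((k + 1 : ℕ) : ℝ≥0∞)⁻¹ * (volume Ω + ((k + 1 : ℕ) : ℝ≥0∞) ^ P * modular p Ω (g n)) := by
    intro k n
    have hk : ‖((k + 1 : ℕ) : ℝ)‖ₑ = ((k + 1 : ℕ) : ℝ≥0∞) := by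
      rw [enorm_eq_nnnorm, Real.nnnorm_natCast]; rfl
    have e1 : ∫⁻ x in Ω, ‖g n x‖ₑ
        = ((k + 1 : ℕ) : ℝ≥0∞)⁻¹ * ∫⁻ x in Ω, ‖(((k + 1 : ℕ) : ℝ) • g n) x‖ₑ := by
      rw [← lintegral_const_mul' _ _ (by simp)]
      refine lintegral_congr fun x => ?_
      rw [Pi.smul_apply, enorm_smul, hk, ← mul_assoc, ENNReal.inv_mul_cancel (by simp) (by simp),
        one_mul]
    rw [e1]
    gcongr
    refine (lintegral_enorm_le_modular hp hΩ).trans ?_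
    gcongr
    rw [← hk]
    refine modular_smul_le_of_one_le hp hΩ hP0 hP ?_
    rw [hk]
    exact_mod_cast Nat.le_add_left 1 k
  rw [ENNReal.tendsto_nhds_zero]
  intro ε hε
  have t1 : Tendsto (fun k : ℕ => ((k + 1 : ℕ) : ℝ≥0∞)⁻¹ * volume Ω) atTop (𝓝 0) := by
    have := ENNReal.Tendsto.mul_const (b := volume Ω)
      ((tendsto_add_atTop_iff_nat 1).2 ENNReal.tendsto_inv_nat_nhds_zero) (Or.inr hV)
    simpa using this
  obtain ⟨k, hk⟩ := (t1.eventually (gt_mem_nhds hε)).exists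
  have t2 : Tendsto (fun n => ((k + 1 : ℕ) : ℝ≥0∞)⁻¹ *
      (volume Ω + ((k + 1 : ℕ) : ℝ≥0∞) ^ P * modular p Ω (g n))) atTop
      (𝓝 (((k + 1 : ℕ) : ℝ≥0∞)⁻¹ * (volume Ω + ((k + 1 : ℕ) : ℝ≥0∞) ^ P * 0))) := by
    refine ENNReal.Tendsto.const_mul ?_ (Or.inr (by simp))
    refine tendsto_const_nhds.add ?_
    exact ENNReal.Tendsto.const_mul h (Or.inr (ENNReal.rpow_ne_top_of_nonneg hP0 (by simp)))
  rw [mul_zero, add_zero] at t2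
  filter_upwards [t2.eventually (gt_mem_nhds hk)] with n hn
  exact (bound k n).trans hn.le

end Modular

/-! ### Sobolev functions with a given gradient -/

/-- `u ∈ W^{1,p(x)}(Ω)` and `G` is its weak gradient. -/
structure HasSobolevGrad (p : E N → ℝ) (Ω : Set (E N)) (u : E N → ℝ) (G : E N → E N) : Prop where
  weak : IsWeakGradient Ω u G
  fun_lt_top : modular p Ω u < ⊤
  grad_lt_top : modular p Ω G < ⊤

lemma MemSobolev.hasSobolevGrad (h : MemSobolev p Ω u) : HasSobolevGrad p Ω u (weakGrad Ω u) :=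
  ⟨weakGrad_spec h.1, h.2.1.2, h.2.2.2⟩

namespace HasSobolevGrad

lemma memSobolev (hΩ : IsOpen Ω) (h : HasSobolevGrad p Ω u G) : MemSobolev p Ω u :=
  ⟨⟨G, h.weak⟩, ⟨h.weak.1, h.fun_lt_top⟩, ⟨(weakGrad_spec ⟨G, h.weak⟩).2.1, by
    rw [modular_congr (h.weak.weakGrad_ae_eq hΩ)]; exact h.grad_lt_top⟩⟩

lemma sobolevModular_eq (hΩ : IsOpen Ω) (h : HasSobolevGrad p Ω u G) :
    sobolevModular p Ω u = modular p Ω u + modular p Ω G := by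
  rw [sobolevModular, modular_congr (h.weak.weakGrad_ae_eq hΩ)]

lemma aestronglyMeasurable (h : HasSobolevGrad p Ω u G) :
    AEStronglyMeasurable u (volume.restrict Ω) := h.weak.1.aestronglyMeasurable

lemma aestronglyMeasurable_grad (h : HasSobolevGrad p Ω u G) :
    AEStronglyMeasurable G (volume.restrict Ω) := h.weak.2.1.aestronglyMeasurable

lemma integrableOn (h : HasSobolevGrad p Ω u G) (hp : IsExponent p Ω) (hΩ : IsOpen Ω)
    (hb : Bornology.IsBounded Ω) : IntegrableOn u Ω :=
  integrableOn_of_modular_lt_top hp hΩ hb h.aestronglyMeasurable h.fun_lt_top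

lemma integrableOn_grad (h : HasSobolevGrad p Ω u G) (hp : IsExponent p Ω) (hΩ : IsOpen Ω)
    (hb : Bornology.IsBounded Ω) : IntegrableOn G Ω :=
  integrableOn_of_modular_lt_top hp hΩ hb h.aestronglyMeasurable_grad h.grad_lt_top

lemma sub (hp : IsExponent p Ω) (hΩ : IsOpen Ω) (hu : HasSobolevGrad p Ω u G)
    (hv : HasSobolevGrad p Ω v H) : HasSobolevGrad p Ω (u - v) (G - H) :=
  ⟨hu.weak.sub hv.weak,
    modular_sub_lt_top hp hΩ hu.aestronglyMeasurable hu.fun_lt_top hv.fun_lt_top,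
    modular_sub_lt_top hp hΩ hu.aestronglyMeasurable_grad hu.grad_lt_top hv.grad_lt_top⟩

lemma smul (hp : IsExponent p Ω) (hΩ : IsOpen Ω) (c : ℝ) (hu : HasSobolevGrad p Ω u G) :
    HasSobolevGrad p Ω (c • u) (c • G) :=
  ⟨hu.weak.smul c, modular_smul_lt_top hp hΩ c hu.fun_lt_top,
    modular_smul_lt_top hp hΩ c hu.grad_lt_top⟩

lemma congr (hΩ : IsOpen Ω) (hu : HasSobolevGrad p Ω u G)
    (huv : u =ᵐ[volume.restrict Ω] v) (hGH : G =ᵐ[volume.restrict Ω] H) :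
    HasSobolevGrad p Ω v H :=
  ⟨hu.weak.congr hΩ huv hGH, modular_congr huv ▸ hu.fun_lt_top, modular_congr hGH ▸ hu.grad_lt_top⟩

lemma mono (hs : Ω' ⊆ Ω) (hu : HasSobolevGrad p Ω u G) : HasSobolevGrad p Ω' u G :=
  ⟨hu.weak.mono hs, (lintegral_mono_set hs).trans_lt hu.fun_lt_top,
    (lintegral_mono_set hs).trans_lt hu.grad_lt_top⟩

lemma zero (hp : IsExponent p Ω) (hΩ : IsOpen Ω) : HasSobolevGrad p Ω (0 : E N → ℝ) 0 :=
  ⟨isWeakGradient_zero, by simp [modular_zero hp hΩ], by simp [modular_zero hp hΩ]⟩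

lemma sobolevModular_smul_eq (hp : IsExponent p Ω) (hΩ : IsOpen Ω) (c : ℝ)
    (hu : HasSobolevGrad p Ω u G) :
    sobolevModular p Ω (c • u) = modular p Ω (c • u) + modular p Ω (c • G) :=
  (hu.smul hp hΩ c).sobolevModular_eq hΩ

/-- With `m` the modular of `u`, the scale `l = m + 1` gives at most `m / (m + 1)`. Thus the infimum
defining the norm runs over a nonempty set, and a norm below `ε` really provides a scale below `ε`.
-/
lemma exists_sobolevModular_lt_one (hp : IsExponent p Ω) (hΩ : IsOpen Ω)
    (hu : HasSobolevGrad p Ω u G) : ∃ l : ℝ, 0 < l ∧ sobolevModular p Ω (l⁻¹ • u) < 1 := by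
  have hm : modular p Ω u + modular p Ω G ≠ ⊤ :=
    (ENNReal.add_lt_top.2 ⟨hu.fun_lt_top, hu.grad_lt_top⟩).ne
  set m := modular p Ω u + modular p Ω G with hm_def
  refine ⟨m.toReal + 1, by positivity, ?_⟩
  have hc : ‖(m.toReal + 1)⁻¹‖ₑ = (m + 1)⁻¹ := by
    rw [enorm_inv (by positivity), Real.enorm_of_nonneg (by positivity),
      ENNReal.ofReal_add (by positivity) zero_le_one, ENNReal.ofReal_toReal hm, ENNReal.ofReal_one]
  have hc1 : ‖(m.toReal + 1)⁻¹‖ₑ ≤ 1 := by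
    rw [hc, ENNReal.inv_le_one]; exact le_add_self
  rw [hu.sobolevModular_smul_eq hp hΩ]
  refine (add_le_add (modular_smul_le_of_le_one hp hΩ hc1)
    (modular_smul_le_of_le_one hp hΩ hc1)).trans_lt ?_
  rw [← mul_add, ← hm_def, hc, mul_comm, ← div_eq_mul_inv]
  rw [ENNReal.div_lt_iff (Or.inl (by simp)) (Or.inl (by simp [hm])), one_mul]
  exact ENNReal.lt_add_right hm (by simp)

/-- A small Luxemburg norm means a small modular. -/
lemma modular_le_of_sobolevNorm_lt (hp : IsExponent p Ω) (hΩ : IsOpen Ω)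
    (hu : HasSobolevGrad p Ω u G) {ε : ℝ} (hε : ε ≤ 1) (h : sobolevNorm p Ω u < ε) :
    modular p Ω u + modular p Ω G ≤ ENNReal.ofReal ε := by
  obtain ⟨l, ⟨hl0, hl⟩, hlε⟩ := exists_lt_of_csInf_lt (hu.exists_sobolevModular_lt_one hp hΩ) h
  have hle : ‖l‖ₑ ≤ 1 := by
    rw [Real.enorm_of_nonneg hl0.le]; exact ENNReal.ofReal_le_one.2 (hlε.le.trans hε)
  rw [hu.sobolevModular_smul_eq hp hΩ] at hl
  have e1 := modular_smul_le_of_le_one (g := l⁻¹ • u) hp hΩ hle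
  have e2 := modular_smul_le_of_le_one (g := l⁻¹ • G) hp hΩ hle
  rw [smul_inv_smul₀ hl0.ne'] at e1 e2
  calc modular p Ω u + modular p Ω G
      ≤ ‖l‖ₑ * (modular p Ω (l⁻¹ • u) + modular p Ω (l⁻¹ • G)) := by
        rw [mul_add]; exact add_le_add e1 e2
    _ ≤ ‖l‖ₑ * 1 := by gcongr
    _ ≤ ENNReal.ofReal ε := by
        rw [mul_one, Real.enorm_of_nonneg hl0.le]; exact ENNReal.ofReal_le_ofReal hlε.le

/-- A small modular means a small Luxemburg norm. -/
lemma sobolevNorm_le_of_modular_lt (hp : IsExponent p Ω) (hΩ : IsOpen Ω) {P : ℝ} (hP0 : 0 ≤ P)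
    (hP : ∀ x ∈ Ω, p x ≤ P) (hu : HasSobolevGrad p Ω u G) {ε : ℝ} (hε0 : 0 < ε) (hε : ε ≤ 1)
    (h : modular p Ω u + modular p Ω G < ENNReal.ofReal ε ^ P) : sobolevNorm p Ω u ≤ ε := by
  refine csInf_le ⟨0, fun l hl => hl.1.le⟩ ⟨hε0, ?_⟩
  have hc : ‖ε⁻¹‖ₑ = (ENNReal.ofReal ε)⁻¹ := by
    rw [enorm_inv hε0.ne', Real.enorm_of_nonneg hε0.le]
  have hc1 : 1 ≤ ‖ε⁻¹‖ₑ := by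
    rw [hc, ENNReal.one_le_inv]; exact ENNReal.ofReal_le_one.2 hε
  rw [hu.sobolevModular_smul_eq hp hΩ]
  refine (add_le_add (modular_smul_le_of_one_le hp hΩ hP0 hP hc1)
    (modular_smul_le_of_one_le hp hΩ hP0 hP hc1)).trans_lt ?_
  rw [← mul_add, hc, ENNReal.inv_rpow, mul_comm, ← div_eq_mul_inv]
  have h0 : ENNReal.ofReal ε ^ P ≠ 0 :=
    (ENNReal.rpow_pos (ENNReal.ofReal_pos.2 hε0) ENNReal.ofReal_ne_top).ne'
  have h1 : ENNReal.ofReal ε ^ P ≠ ⊤ := ENNReal.rpow_ne_top_of_nonneg hP0 ENNReal.ofReal_ne_top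
  rwa [ENNReal.div_lt_iff (Or.inl h0) (Or.inl h1), one_mul]

end HasSobolevGrad

/-- Approximation of `u`, with gradient `G`, by the compactly supported `φ n`, with gradients
`Γ n`. -/
structure IsApproxSeq (p : E N → ℝ) (Ω : Set (E N)) (u : E N → ℝ) (G : E N → E N)
    (φ : ℕ → E N → ℝ) (Γ : ℕ → E N → E N) : Prop where
  grad : ∀ n, HasSobolevGrad p Ω (φ n) (Γ n)
  compact : ∀ n, HasCompactSupport (φ n)
  tsupport_subset : ∀ n, tsupport (φ n) ⊆ Ω
  tendsto_fun : Tendsto (fun n => modular p Ω (φ n - u)) atTop (𝓝 0)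
  tendsto_grad : Tendsto (fun n => modular p Ω (Γ n - G)) atTop (𝓝 0)

lemma modular_sub_comm {F : Type*} [NormedAddCommGroup F] {g h : E N → F} :
    modular p Ω (g - h) = modular p Ω (h - g) := by
  rw [← modular_neg, neg_sub]

/-- This and `IsApproxSeq.memSobolevZero` translate between the norm closure and convergence of
modulars, so that later arguments can work with integrals only. -/
lemma MemSobolevZero.exists_isApproxSeq (hp : IsExponent p Ω) (hΩ : IsOpen Ω)
    (hu : MemSobolevZero p Ω u) (hG : IsWeakGradient Ω u G) :
    ∃ φ Γ, IsApproxSeq p Ω u G φ Γ := by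
  have hu' : HasSobolevGrad p Ω u G := hu.2.1.hasSobolevGrad.congr hΩ EventuallyEq.rfl
    (hG.weakGrad_ae_eq hΩ)
  have hε : ∀ n : ℕ, (0 : ℝ) < 1 / (n + 1) := fun n => by positivity
  choose φ h1 h2 h3 h4 using fun n : ℕ => hu.2.2 (1 / (n + 1)) (hε n)
  have hφ : ∀ n, HasSobolevGrad p Ω (φ n) (weakGrad Ω (φ n)) := fun n => (h1 n).hasSobolevGrad
  have key : ∀ n : ℕ, modular p Ω (u - φ n) + modular p Ω (G - weakGrad Ω (φ n)) ≤
      ENNReal.ofReal (1 / (n + 1)) := fun n =>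
    (hu'.sub hp hΩ (hφ n)).modular_le_of_sobolevNorm_lt hp hΩ
      (by rw [div_le_one (by positivity)]; linarith [(Nat.cast_nonneg n : (0 : ℝ) ≤ n)]) (h4 n)
  have lim : Tendsto (fun n : ℕ => ENNReal.ofReal (1 / (n + 1))) atTop (𝓝 0) := by
    rw [← ENNReal.ofReal_zero]
    exact ENNReal.tendsto_ofReal tendsto_one_div_add_atTop_nhds_zero_nat
  refine ⟨φ, fun n => weakGrad Ω (φ n), hφ, h2, h3, ?_, ?_⟩
  · refine tendsto_of_tendsto_of_tendsto_of_le_of_le tendsto_const_nhds lim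
      (fun _ => zero_le) fun n => ?_
    rw [modular_sub_comm]
    exact le_self_add.trans (key n)
  · refine tendsto_of_tendsto_of_tendsto_of_le_of_le tendsto_const_nhds lim
      (fun _ => zero_le) fun n => ?_
    rw [modular_sub_comm]
    exact le_add_self.trans (key n)

lemma IsApproxSeq.memSobolevZero (hp : IsExponent p Ω) (hΩ : IsOpen Ω)
    {φ : ℕ → E N → ℝ} {Γ : ℕ → E N → E N} (h : IsApproxSeq p Ω u G φ Γ)
    (hu : HasSobolevGrad p Ω u G) (h0 : ∀ x ∉ Ω, u x = 0) : MemSobolevZero p Ω u := by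
  obtain ⟨P, hP0, hP⟩ := hp.exists_bound
  refine ⟨h0, hu.memSobolev hΩ, fun ε hε => ?_⟩
  -- The norm estimate is not strict, hence `ε / 2`; it also requires a bound of at most `1`.
  have hδ : 0 < min (ε / 2) 1 := by positivity
  have hpos : 0 < ENNReal.ofReal (min (ε / 2) 1) ^ P :=
    ENNReal.rpow_pos (ENNReal.ofReal_pos.2 hδ) ENNReal.ofReal_ne_top
  have lim := h.tendsto_fun.add h.tendsto_grad
  rw [add_zero] at lim
  obtain ⟨n, hn⟩ := (lim.eventually (gt_mem_nhds hpos)).exists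
  refine ⟨φ n, (h.grad n).memSobolev hΩ, h.compact n, h.tsupport_subset n, ?_⟩
  rw [modular_sub_comm, modular_sub_comm (g := Γ n)] at hn
  refine ((hu.sub hp hΩ (h.grad n)).sobolevNorm_le_of_modular_lt hp hΩ hP0 hP hδ
    (min_le_right _ _) hn).trans_lt ?_
  exact (min_le_left _ _).trans_lt (half_lt_self hε)

/-! ### Mollification in `L¹` -/

/-- Write `aₙ bₙ = (aₙ - a₀) bₙ + a₀ bₙ`: the first term tends to zero in `L¹` since `bₙ` is
bounded, the second converges by domination with `C |a₀|`. -/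
lemma tendsto_integral_mul_of_L1 {α : Type*} [MeasurableSpace α] {μ : Measure α}
    {a b : ℕ → α → ℝ} {a₀ b₀ : α → ℝ} {C : ℝ} (ha : ∀ n, Integrable (a n) μ)
    (ha₀ : Integrable a₀ μ)
    (hab : Tendsto (fun n => ∫⁻ x, ‖a n x - a₀ x‖ₑ ∂μ) atTop (𝓝 0))
    (hb : ∀ n, AEStronglyMeasurable (b n) μ) (hC : ∀ n x, ‖b n x‖ ≤ C)
    (hlim : ∀ᵐ x ∂μ, Tendsto (fun n => b n x) atTop (𝓝 (b₀ x))) :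
    Tendsto (fun n => ∫ x, a n x * b n x ∂μ) atTop (𝓝 (∫ x, a₀ x * b₀ x ∂μ)) := by
  have i1 : ∀ n, Integrable (fun x => (a n x - a₀ x) * b n x) μ := fun n =>
    ((ha n).sub ha₀).mul_bdd (hb n) (Eventually.of_forall (hC n))
  have i2 : ∀ n, Integrable (fun x => a₀ x * b n x) μ := fun n =>
    ha₀.mul_bdd (hb n) (Eventually.of_forall (hC n))
  have t1 : Tendsto (fun n => ∫ x, (a n x - a₀ x) * b n x ∂μ) atTop (𝓝 (∫ _, (0 : ℝ) ∂μ)) := by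
    refine tendsto_integral_of_L1 _ aestronglyMeasurable_const (Eventually.of_forall i1) ?_
    have t : Tendsto (fun n => ENNReal.ofReal C * ∫⁻ x, ‖a n x - a₀ x‖ₑ ∂μ) atTop
        (𝓝 (ENNReal.ofReal C * 0)) := ENNReal.Tendsto.const_mul hab (Or.inr ENNReal.ofReal_ne_top)
    rw [mul_zero] at t
    refine tendsto_of_tendsto_of_tendsto_of_le_of_le tendsto_const_nhds t
      (fun _ => zero_le) fun n => ?_
    simp only
    rw [← lintegral_const_mul' _ _ ENNReal.ofReal_ne_top]
    refine lintegral_mono fun x => ?_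
    rw [sub_zero, enorm_mul, mul_comm]
    gcongr
    rw [← ofReal_norm]
    exact ENNReal.ofReal_le_ofReal (hC n x)
  have t2 : Tendsto (fun n => ∫ x, a₀ x * b n x ∂μ) atTop (𝓝 (∫ x, a₀ x * b₀ x ∂μ)) := by
    refine tendsto_integral_of_dominated_convergence (fun x => ‖a₀ x‖ * C)
      (fun n => (i2 n).1) (ha₀.norm.mul_const C)
      (fun n => Eventually.of_forall fun x => ?_) (hlim.mono fun x hx => hx.const_mul _)
    rw [norm_mul]
    exact mul_le_mul_of_nonneg_left (hC n x) (norm_nonneg _)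
  have t3 := t1.add t2
  rw [integral_zero, zero_add] at t3
  refine t3.congr fun n => ?_
  rw [← integral_add (i1 n) (i2 n)]
  exact integral_congr_ae (Eventually.of_forall fun x => by simp only; ring)

/-- The mollification of `g` by the normalized bump function `φ`. -/
noncomputable def mollify (φ : ContDiffBump (0 : E N)) (g : E N → ℝ) : E N → ℝ :=
  φ.normed volume ⋆[ContinuousLinearMap.lsmul ℝ ℝ, volume] g

lemma integrable_mollify (φ : ContDiffBump (0 : E N)) {g : E N → ℝ} (hg : Integrable g) :
    Integrable (mollify φ g) :=
  φ.integrable_normed.integrable_convolution _ hg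

lemma convolutionExists_bump (φ : ContDiffBump (0 : E N)) {g : E N → ℝ} (hg : Integrable g) :
    ConvolutionExists (φ.normed volume) g (ContinuousLinearMap.lsmul ℝ ℝ) volume :=
  φ.hasCompactSupport_normed.convolutionExists_left _ φ.continuous_normed hg.locallyIntegrable

lemma integral_mollify (φ : ContDiffBump (0 : E N)) {g : E N → ℝ} (hg : Integrable g) :
    ∫ x, mollify φ g x = ∫ x, g x := by
  unfold mollify
  rw [integral_convolution _ φ.integrable_normed hg, φ.integral_normed]
  simp

lemma contDiff_mollify (φ : ContDiffBump (0 : E N)) {g : E N → ℝ} (hg : Integrable g) :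
    ContDiff ℝ 1 (mollify φ g) :=
  φ.hasCompactSupport_normed.contDiff_convolution_left (n := 1) _ φ.contDiff_normed
    hg.locallyIntegrable

lemma ae_tendsto_mollify {φ : ℕ → ContDiffBump (0 : E N)}
    (hφ : Tendsto (fun n => (φ n).rOut) atTop (𝓝 0)) (hφ' : ∀ n, (φ n).rOut ≤ 2 * (φ n).rIn)
    {g : E N → ℝ} (hg : Integrable g) :
    ∀ᵐ x, Tendsto (fun n => mollify (φ n) g x) atTop (𝓝 (g x)) :=
  ContDiffBump.ae_convolution_tendsto_right_of_locallyIntegrable hφ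
    (Eventually.of_forall hφ') hg.locallyIntegrable

/-- A Scheffé argument: mollification preserves the integral, so the `L¹` distance is twice the
integral of `(g - mollify g)⁺`. For `g ≥ 0` this positive part is dominated by `g` and tends to zero
a.e. -/
lemma tendsto_mollify_of_nonneg {φ : ℕ → ContDiffBump (0 : E N)}
    (hφ : Tendsto (fun n => (φ n).rOut) atTop (𝓝 0)) (hφ' : ∀ n, (φ n).rOut ≤ 2 * (φ n).rIn)
    {g : E N → ℝ} (hg : Integrable g) (h0 : ∀ x, 0 ≤ g x) :
    Tendsto (fun n => ∫⁻ x, ‖mollify (φ n) g x - g x‖ₑ) atTop (𝓝 0) := by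
  have hn0 : ∀ n x, 0 ≤ mollify (φ n) g x := fun n x =>
    integral_nonneg fun t => mul_nonneg ((φ n).nonneg_normed t) (h0 _)
  have hsub : ∀ n, Integrable (fun x => g x - mollify (φ n) g x) := fun n =>
    hg.sub (integrable_mollify _ hg)
  have t1 : Tendsto (fun n => ∫ x, max (g x - mollify (φ n) g x) 0) atTop
      (𝓝 (∫ _ : E N, (0 : ℝ))) := by
    refine tendsto_integral_of_dominated_convergence g (fun n => (hsub n).pos_part.1) hg
      (fun n => Eventually.of_forall fun x => ?_) ?_
    · rw [Real.norm_of_nonneg (le_max_right _ _)]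
      exact max_le (by linarith [hn0 n x]) (h0 x)
    · filter_upwards [ae_tendsto_mollify hφ hφ' hg] with x hx
      have := ((tendsto_const_nhds (x := g x)).sub hx).max (tendsto_const_nhds (x := (0 : ℝ)))
      simpa using this
  have e : ∀ n, ∫ x, ‖mollify (φ n) g x - g x‖ = 2 * ∫ x, max (g x - mollify (φ n) g x) 0 := by
    intro n
    have : ∫ x, ‖mollify (φ n) g x - g x‖
        = ∫ x, (2 * max (g x - mollify (φ n) g x) 0 - (g x - mollify (φ n) g x)) := by
      refine integral_congr_ae (Eventually.of_forall fun x => ?_)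
      simp only [Real.norm_eq_abs]
      rcases le_total (mollify (φ n) g x) (g x) with h | h
      · rw [abs_of_nonpos (by linarith), max_eq_left (by linarith)]; ring
      · rw [abs_of_nonneg (by linarith), max_eq_right (by linarith)]; ring
    rw [this, integral_sub ((hsub n).pos_part.const_mul 2) (hsub n), integral_const_mul,
      integral_sub hg (integrable_mollify _ hg), integral_mollify _ hg, sub_self, sub_zero]
  have t2 : Tendsto (fun n => ENNReal.ofReal (∫ x, ‖mollify (φ n) g x - g x‖)) atTop (𝓝 0) := by
    rw [← ENNReal.ofReal_zero]
    refine ENNReal.tendsto_ofReal ?_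
    simp only [e]
    simpa using t1.const_mul 2
  refine t2.congr fun n => ?_
  exact ofReal_integral_norm_eq_lintegral_enorm ((integrable_mollify _ hg).sub hg)

lemma tendsto_mollify {φ : ℕ → ContDiffBump (0 : E N)}
    (hφ : Tendsto (fun n => (φ n).rOut) atTop (𝓝 0)) (hφ' : ∀ n, (φ n).rOut ≤ 2 * (φ n).rIn)
    {g : E N → ℝ} (hg : Integrable g) :
    Tendsto (fun n => ∫⁻ x, ‖mollify (φ n) g x - g x‖ₑ) atTop (𝓝 0) := by
  set a : E N → ℝ := fun x => max (g x) 0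
  set b : E N → ℝ := fun x => max (-g x) 0
  have ha : Integrable a := hg.pos_part
  have hb : Integrable b := hg.neg_part
  have hab : g + b = a := by
    ext x
    simp only [Pi.add_apply, a, b]
    rcases le_total 0 (g x) with h | h
    · rw [max_eq_left h, max_eq_right (by linarith)]; ring
    · rw [max_eq_right h, max_eq_left (by linarith)]; ring
  have hm : ∀ n x, mollify (φ n) g x + mollify (φ n) b x = mollify (φ n) a x := by
    intro n x
    rw [← hab]
    exact ((convolutionExists_bump (φ n) hg x).distrib_add (convolutionExists_bump (φ n) hb x)).symm
  have t := (tendsto_mollify_of_nonneg hφ hφ' ha fun x => le_max_right _ _).add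
    (tendsto_mollify_of_nonneg hφ hφ' hb fun x => le_max_right _ _)
  rw [add_zero] at t
  refine tendsto_of_tendsto_of_tendsto_of_le_of_le tendsto_const_nhds t
    (fun _ => zero_le) fun n => ?_
  simp only
  have hm1 : AEMeasurable (fun x => ‖mollify (φ n) a x - a x‖ₑ) :=
    ((integrable_mollify (φ n) ha).sub ha).1.enorm
  rw [← lintegral_add_left' hm1]
  refine lintegral_mono fun x => ?_
  have : mollify (φ n) g x - g x
      = (mollify (φ n) a x - a x) - (mollify (φ n) b x - b x) := by
    rw [← hm, ← hab]
    simp only [Pi.add_apply]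
    ring
  rw [this]
  exact enorm_sub_le

/-- The derivatives of a mollification are the mollified weak derivatives. -/
lemma IsWeakGradient.fderiv_mollify (hΩ : IsOpen Ω) (hu : IsWeakGradient Ω u G)
    (hui : IntegrableOn u Ω) (φ : ContDiffBump (0 : E N))
    {x : E N} (hx : Metric.closedBall x φ.rOut ⊆ Ω) (i : Fin N) :
    fderiv ℝ (mollify φ (Ω.indicator u)) x (EuclideanSpace.single i 1)
      = mollify φ (Ω.indicator fun y => G y i) x := by
  set ρ := φ.normed volume with hρ
  set e : E N := EuclideanSpace.single i 1
  have hρd : ContDiff ℝ ∞ ρ := φ.contDiff_normed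
  have hρc : HasCompactSupport ρ := φ.hasCompactSupport_normed
  have hui' : Integrable (Ω.indicator u) := (integrable_indicator_iff hΩ.measurableSet).2 hui
  -- The reflected kernel centred at `x` is supported in the ball assumed to lie in `Ω`, so it can
  -- be inserted in the definition of the weak gradient.
  have hψ : IsTestFunction Ω (fun y => ρ (x - y)) := by
    refine ⟨hρd.comp (contDiff_const.sub contDiff_id),
      hρc.comp_homeomorph (Homeomorph.subLeft x), ?_⟩
    refine (tsupport_comp_subset_preimage ρ (f := fun y => x - y) (by fun_prop)).trans ?_
    rw [hρ, φ.tsupport_normed_eq]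
    intro y hy
    apply hx
    rw [Set.mem_preimage, mem_closedBall_zero_iff] at hy
    rwa [Metric.mem_closedBall, dist_comm, dist_eq_norm]
  have hfd : ∀ y, fderiv ℝ (fun y => ρ (x - y)) y e = -fderiv ℝ ρ (x - y) e := by
    intro y
    have h1 : HasFDerivAt ρ (fderiv ℝ ρ (x - y)) (x - y) :=
      (hρd.differentiable (by simp) _).hasFDerivAt
    have h2 : HasFDerivAt (fun y => x - y) (-ContinuousLinearMap.id ℝ (E N)) y :=
      (hasFDerivAt_id y).const_sub x
    have h3 : HasFDerivAt (fun y => ρ (x - y)) _ y := h1.comp y h2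
    rw [h3.fderiv]
    simp
  have h1 := (hρc.hasFDerivAt_convolution_left (ContinuousLinearMap.lsmul ℝ ℝ)
    (φ.contDiff_normed) hui'.locallyIntegrable x).fderiv
  have hex := (hρc.fderiv (𝕜 := ℝ)).convolutionExists_left
    ((ContinuousLinearMap.lsmul ℝ ℝ).precompL (E N)) (hρd.continuous_fderiv (by simp))
    hui'.locallyIntegrable x
  rw [convolutionExistsAt_iff_integrable_swap] at hex
  unfold mollify
  rw [h1, convolution_eq_swap, convolution_eq_swap, ContinuousLinearMap.integral_apply hex]
  have key := hu.2.2 _ hψ i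
  have e1 : ∫ y, ((((ContinuousLinearMap.lsmul ℝ ℝ).precompL (E N)) (fderiv ℝ ρ (x - y)))
      (Ω.indicator u y)) e = -∫ y in Ω, u y * fderiv ℝ (fun y => ρ (x - y)) y e := by
    rw [← integral_neg, ← integral_indicator hΩ.measurableSet]
    refine integral_congr_ae (Eventually.of_forall fun y => ?_)
    by_cases hy : y ∈ Ω
    · simp [hy, hfd, ContinuousLinearMap.precompL_apply, mul_comm]
    · simp [hy]
  have e2 : ∫ y, ((ContinuousLinearMap.lsmul ℝ ℝ) (ρ (x - y))) (Ω.indicator (fun y => G y i) y)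
      = ∫ y in Ω, G y i * ρ (x - y) := by
    rw [← integral_indicator hΩ.measurableSet]
    refine integral_congr_ae (Eventually.of_forall fun y => ?_)
    by_cases hy : y ∈ Ω
    · simp [hy, mul_comm]
    · simp [hy]
  rw [e1, e2, key, neg_neg]

/-! ### Chain rule and positive part -/

/-- The ratio bound between the radii is what a.e. convergence of mollifications requires; the bound
by `δ` keeps the mollification balls inside the domain. -/
lemma exists_bump_seq {δ : ℝ} (hδ : 0 < δ) : ∃ φ : ℕ → ContDiffBump (0 : E N),
    Tendsto (fun n => (φ n).rOut) atTop (𝓝 0) ∧ (∀ n, (φ n).rOut ≤ 2 * (φ n).rIn) ∧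
      ∀ n, (φ n).rOut ≤ δ := by
  have hpos : ∀ n : ℕ, 0 < δ / (n + 1) := fun n => by positivity
  refine ⟨fun n => ⟨δ / (n + 1) / 2, δ / (n + 1), half_pos (hpos n), half_lt_self (hpos n)⟩,
    ?_, fun n => ?_, fun n => ?_⟩
  · have := tendsto_one_div_add_atTop_nhds_zero_nat.const_mul δ
    simpa [div_eq_mul_inv] using this
  · simp only; linarith
  · exact div_le_self hδ.le (by linarith [(Nat.cast_nonneg n : (0 : ℝ) ≤ n)])

lemma norm_comp_sub_le {F : ℝ → ℝ} (hF : ContDiff ℝ 1 F) (hb : ∀ t, |deriv F t| ≤ 1) (s t : ℝ) :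
    ‖F s - F t‖ ≤ ‖s - t‖ := by
  simpa using Convex.norm_image_sub_le_of_norm_deriv_le (s := Set.univ) (C := 1)
    (fun x _ => hF.differentiable (by simp) x) (fun x _ => hb x) convex_univ
    (Set.mem_univ t) (Set.mem_univ s)

/-- Chain rule for a `C¹` function with bounded derivative. -/
lemma IsWeakGradient.integral_comp (hΩ : IsOpen Ω) (hu : IsWeakGradient Ω u G)
    (hui : IntegrableOn u Ω) (hGi : IntegrableOn G Ω) {F : ℝ → ℝ} (hF : ContDiff ℝ 1 F)
    (hF0 : F 0 = 0) (hb : ∀ t, |deriv F t| ≤ 1) {ψ : E N → ℝ} (hψ : IsTestFunction Ω ψ)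
    (i : Fin N) :
    ∫ x in Ω, F (u x) * fderiv ℝ ψ x (EuclideanSpace.single i 1)
      = -∫ x in Ω, G x i * (deriv F (u x) * ψ x) := by
  set e : E N := EuclideanSpace.single i 1
  -- The gradient of a mollification is identified only away from `∂Ω`, which suffices because it is
  -- multiplied by `ψ`.
  obtain ⟨δ, hδ, hδΩ⟩ := hψ.2.1.isCompact.exists_cthickening_subset_open hΩ hψ.2.2
  obtain ⟨φ, hφ, hφ', hφδ⟩ := exists_bump_seq (N := N) hδ
  have hball : ∀ n, ∀ x ∈ tsupport ψ, Metric.closedBall x (φ n).rOut ⊆ Ω := fun n x hx =>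
    ((Metric.closedBall_subset_closedBall (hφδ n)).trans
      (Metric.closedBall_subset_cthickening hx δ)).trans hδΩ
  set U : E N → ℝ := Ω.indicator u with hU
  set g : E N → ℝ := Ω.indicator (fun y => G y i) with hg
  have hUi : Integrable U := (integrable_indicator_iff hΩ.measurableSet).2 hui
  have hgi : Integrable g := (integrable_indicator_iff hΩ.measurableSet).2
    ((EuclideanSpace.proj (𝕜 := ℝ) i).integrable_comp hGi)
  set w : ℕ → E N → ℝ := fun n => mollify (φ n) U with hw
  have hwd : ∀ n, ContDiff ℝ 1 (w n) := fun n => contDiff_mollify (φ n) hUi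
  have hwi : ∀ n, Integrable (w n) := fun n => integrable_mollify (φ n) hUi
  have hF' : Continuous (deriv F) := hF.continuous_deriv (by simp)
  have hFle : ∀ t, ‖F t‖ ≤ ‖t‖ := fun t => by
    simpa [hF0] using norm_comp_sub_le hF hb t 0
  have hFi : ∀ {f : E N → ℝ}, Integrable f → Integrable (fun x => F (f x)) := fun hf =>
    hf.mono (hF.continuous.comp_aestronglyMeasurable hf.1) (Eventually.of_forall fun x => hFle _)
  obtain ⟨C₁, hC₁⟩ := (hψ.hasCompactSupport_fderiv_apply e).exists_bound_of_continuous
    (hψ.continuous_fderiv_apply e)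
  obtain ⟨C₂, hC₂⟩ := hψ.2.1.exists_bound_of_continuous hψ.1.continuous
  have parts : ∀ n, ∫ x, F (w n x) * fderiv ℝ ψ x e
      = -∫ x, mollify (φ n) g x * (deriv F (w n x) * ψ x) := by
    intro n
    have hFd : ContDiff ℝ 1 (fun x => F (w n x)) := hF.comp (hwd n)
    have hc : Continuous (fun x => fderiv ℝ (fun x => F (w n x)) x e) :=
      (hFd.continuous_fderiv (by simp)).clm_apply continuous_const
    have := integral_mul_fderiv_eq_neg_fderiv_mul_of_integrable (μ := volume)
      (f := fun x => F (w n x)) (g := ψ) (v := e)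
      ((hc.mul hψ.1.continuous).integrable_of_hasCompactSupport hψ.2.1.mul_left)
      ((hFd.continuous.mul (hψ.continuous_fderiv_apply e)).integrable_of_hasCompactSupport
        (hψ.hasCompactSupport_fderiv_apply e).mul_left)
      ((hFd.continuous.mul hψ.1.continuous).integrable_of_hasCompactSupport hψ.2.1.mul_left)
      (fun x _ => hFd.differentiable (by simp) x) (fun x _ => hψ.1.differentiable (by simp) x)
    rw [this, neg_inj]
    refine integral_congr_ae (Eventually.of_forall fun x => ?_)
    simp only
    by_cases hx : x ∈ tsupport ψ
    · have h1 : HasDerivAt F (deriv F (w n x)) (w n x) :=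
        (hF.differentiable (by simp) _).hasDerivAt
      have h2 : HasFDerivAt (w n) (fderiv ℝ (w n) x) x :=
        ((hwd n).differentiable (by simp) _).hasFDerivAt
      have h3 : HasFDerivAt (fun x => F (w n x)) _ x := h1.comp_hasFDerivAt x h2
      have h4 : fderiv ℝ (w n) x e = mollify (φ n) g x :=
        hu.fderiv_mollify hΩ hui (φ n) (hball n x hx) i
      rw [h3.fderiv, _root_.smul_apply, h4, smul_eq_mul]
      ring
    · simp [image_eq_zero_of_notMem_tsupport hx]
  have hae := ae_tendsto_mollify hφ hφ' hUi
  have t1 : Tendsto (fun n => ∫ x, F (w n x) * fderiv ℝ ψ x e) atTop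
      (𝓝 (∫ x, F (U x) * fderiv ℝ ψ x e)) := by
    refine tendsto_integral_mul_of_L1 (b := fun _ x => fderiv ℝ ψ x e) (fun n => hFi (hwi n))
      (hFi hUi) ?_ (fun n => (hψ.continuous_fderiv_apply e).aestronglyMeasurable) (fun _ => hC₁)
      (Eventually.of_forall fun x => tendsto_const_nhds)
    refine tendsto_of_tendsto_of_tendsto_of_le_of_le tendsto_const_nhds
      (tendsto_mollify hφ hφ' hUi) (fun _ => zero_le) fun n => lintegral_mono fun x => ?_
    exact enorm_le_iff_norm_le.2 (norm_comp_sub_le hF hb _ _)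
  have t2 : Tendsto (fun n => ∫ x, mollify (φ n) g x * (deriv F (w n x) * ψ x)) atTop
      (𝓝 (∫ x, g x * (deriv F (U x) * ψ x))) := by
    refine tendsto_integral_mul_of_L1 (b := fun n x => deriv F (w n x) * ψ x) (C := C₂)
      (fun n => integrable_mollify (φ n) hgi) hgi (tendsto_mollify hφ hφ' hgi)
      (fun n => ((hF'.comp (hwd n).continuous).mul hψ.1.continuous).aestronglyMeasurable)
      (fun n x => ?_) ?_
    · rw [norm_mul]
      have := mul_le_mul (hb (w n x)) (hC₂ x) (norm_nonneg _) zero_le_one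
      simpa using this
    · filter_upwards [hae] with x hx
      exact ((hF'.tendsto _).comp hx).mul_const _
  have hlim := tendsto_nhds_unique t1 ((t2.neg).congr fun n => (parts n).symm)
  have z1 : ∫ x in Ω, F (u x) * fderiv ℝ ψ x e = ∫ x, F (U x) * fderiv ℝ ψ x e := by
    rw [← integral_indicator hΩ.measurableSet]
    refine integral_congr_ae (Eventually.of_forall fun x => ?_)
    by_cases hx : x ∈ Ω
    · simp [hU, hx]
    · simp [hU, hx, hF0]
  have z2 : ∫ x in Ω, G x i * (deriv F (u x) * ψ x) = ∫ x, g x * (deriv F (U x) * ψ x) := by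
    rw [← integral_indicator hΩ.measurableSet]
    refine integral_congr_ae (Eventually.of_forall fun x => ?_)
    by_cases hx : x ∈ Ω
    · simp [hU, hg, hx]
    · simp [hU, hg, hx]
  rw [z1, z2, hlim]

/-- A continuous approximation of the indicator function of `(0, ∞)`. -/
noncomputable def ramp (k : ℕ) (t : ℝ) : ℝ := max 0 (min 1 (k * t))

/-- The primitive of `ramp k`, an approximation of the positive part. -/
noncomputable def rampInt (k : ℕ) (t : ℝ) : ℝ := ∫ s in (0 : ℝ)..t, ramp k s

lemma continuous_ramp (k : ℕ) : Continuous (ramp k) := by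
  unfold ramp; fun_prop

lemma abs_ramp_le (k : ℕ) (t : ℝ) : |ramp k t| ≤ 1 := by
  rw [abs_of_nonneg (le_max_left _ _)]
  exact max_le zero_le_one (min_le_left _ _)

lemma deriv_rampInt (k : ℕ) : deriv (rampInt k) = ramp k := by
  ext t
  exact (continuous_ramp k).deriv_integral _ _ _

lemma contDiff_rampInt (k : ℕ) : ContDiff ℝ 1 (rampInt k) := by
  rw [contDiff_one_iff_deriv, deriv_rampInt]
  refine ⟨fun t => ?_, continuous_ramp k⟩
  exact (intervalIntegral.integral_hasDerivAt_right
    ((continuous_ramp k).intervalIntegrable _ _)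
    (continuous_ramp k).stronglyMeasurable.stronglyMeasurableAtFilter
    (continuous_ramp k).continuousAt).differentiableAt

lemma rampInt_zero (k : ℕ) : rampInt k 0 = 0 := by simp [rampInt]

lemma norm_rampInt_le (k : ℕ) (t : ℝ) : ‖rampInt k t‖ ≤ ‖t‖ := by
  have := norm_comp_sub_le (contDiff_rampInt k) (by simpa [deriv_rampInt] using abs_ramp_le k) t 0
  simpa [rampInt_zero] using this

open Classical in
-- Every `ramp k` vanishes at `0`, so the limit is the indicator of the open half line; this is why
-- the gradient of a positive part carries a strict inequality.
lemma tendsto_ramp (t : ℝ) :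
    Tendsto (fun k => ramp k t) atTop (𝓝 (if 0 < t then 1 else 0)) := by
  split_ifs with h
  · refine tendsto_const_nhds.congr' ?_
    obtain ⟨k₀, hk₀⟩ := exists_nat_gt (1 / t)
    filter_upwards [eventually_ge_atTop k₀] with k hk
    have : 1 ≤ k * t := by
      rw [div_lt_iff₀ h] at hk₀
      have : (k₀ : ℝ) * t ≤ k * t := by gcongr
      linarith
    simp [ramp, this]
  · refine tendsto_const_nhds.congr fun k => ?_
    have : (k : ℝ) * t ≤ 0 := mul_nonpos_of_nonneg_of_nonpos (by positivity) (not_lt.1 h)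
    rw [ramp, min_eq_right (this.trans zero_le_one), max_eq_left this]

lemma tendsto_rampInt (t : ℝ) : Tendsto (fun k => rampInt k t) atTop (𝓝 (max t 0)) := by
  classical
  have h1 : Tendsto (fun k => rampInt k t) atTop
      (𝓝 (∫ s in (0 : ℝ)..t, if 0 < s then (1 : ℝ) else 0)) := by
    refine intervalIntegral.tendsto_integral_filter_of_dominated_convergence (fun _ => 1)
      (Eventually.of_forall fun k => (continuous_ramp k).aestronglyMeasurable)
      (Eventually.of_forall fun k => Eventually.of_forall fun s _ => abs_ramp_le k s)
      intervalIntegrable_const (Eventually.of_forall fun s _ => tendsto_ramp s)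
  convert h1 using 2
  rcases le_total 0 t with h | h
  · rw [max_eq_left h, intervalIntegral.integral_of_le h,
      setIntegral_congr_fun (g := fun _ => (1 : ℝ)) measurableSet_Ioc
        (fun s hs => if_pos hs.1)]
    simp [h]
  · rw [max_eq_right h, intervalIntegral.integral_of_ge h,
      setIntegral_congr_fun (g := fun _ => (0 : ℝ)) measurableSet_Ioc
        (fun s hs => if_neg (not_lt.2 hs.2))]
    simp

/-- The weak gradient of the positive part. -/
lemma IsWeakGradient.posPart (hΩ : IsOpen Ω) (hu : IsWeakGradient Ω u G)
    (hui : IntegrableOn u Ω) (hGi : IntegrableOn G Ω) :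
    IsWeakGradient Ω (fun x => max (u x) 0) ({x | 0 < u x}.indicator G) := by
  classical
  have hset : NullMeasurableSet {x | 0 < u x} (volume.restrict Ω) :=
    nullMeasurableSet_lt aemeasurable_const hui.aestronglyMeasurable.aemeasurable
  refine ⟨IntegrableOn.locallyIntegrableOn hui.pos_part,
    IntegrableOn.locallyIntegrableOn (hGi.indicator₀ hset),
    fun ψ hψ i => ?_⟩
  set e : E N := EuclideanSpace.single i 1
  have hGi' : IntegrableOn (fun x => G x i) Ω :=
    (EuclideanSpace.proj (𝕜 := ℝ) i).integrable_comp hGi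
  obtain ⟨C₁, hC₁⟩ := (hψ.hasCompactSupport_fderiv_apply e).exists_bound_of_continuous
    (hψ.continuous_fderiv_apply e)
  obtain ⟨C₂, hC₂⟩ := hψ.2.1.exists_bound_of_continuous hψ.1.continuous
  have hid := fun k : ℕ => hu.integral_comp hΩ hui hGi (contDiff_rampInt k) (rampInt_zero k)
    (by simpa [deriv_rampInt] using abs_ramp_le k) hψ i
  simp only [deriv_rampInt] at hid
  have t1 : Tendsto (fun k => ∫ x in Ω, rampInt k (u x) * fderiv ℝ ψ x e) atTop
      (𝓝 (∫ x in Ω, max (u x) 0 * fderiv ℝ ψ x e)) := by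
    refine tendsto_integral_of_dominated_convergence (fun x => ‖u x‖ * C₁) (fun k => ?_)
      (hui.norm.mul_const C₁) (fun k => Eventually.of_forall fun x => ?_)
      (Eventually.of_forall fun x => (tendsto_rampInt (u x)).mul_const _)
    · exact ((contDiff_rampInt k).continuous.comp_aestronglyMeasurable
        hui.aestronglyMeasurable).mul (hψ.continuous_fderiv_apply e).aestronglyMeasurable
    · rw [norm_mul]
      exact mul_le_mul (norm_rampInt_le k _) (hC₁ x) (norm_nonneg _) (norm_nonneg _)
  have t2 : Tendsto (fun k => ∫ x in Ω, G x i * (ramp k (u x) * ψ x)) atTop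
      (𝓝 (∫ x in Ω, G x i * ((if 0 < u x then 1 else 0) * ψ x))) := by
    refine tendsto_integral_of_dominated_convergence (fun x => ‖G x i‖ * C₂) (fun k => ?_)
      (hGi'.norm.mul_const C₂) (fun k => Eventually.of_forall fun x => ?_)
      (Eventually.of_forall fun x => ((tendsto_ramp (u x)).mul_const _).const_mul _)
    · exact hGi'.aestronglyMeasurable.mul (((continuous_ramp k).comp_aestronglyMeasurable
        hui.aestronglyMeasurable).mul hψ.1.continuous.aestronglyMeasurable)
    · rw [norm_mul, norm_mul]
      refine mul_le_mul_of_nonneg_left ?_ (norm_nonneg _)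
      have := mul_le_mul (abs_ramp_le k (u x)) (hC₂ x) (norm_nonneg _) zero_le_one
      simpa using this
  rw [tendsto_nhds_unique t1 (t2.neg.congr fun k => (hid k).symm), neg_inj]
  refine integral_congr_ae (Eventually.of_forall fun x => ?_)
  by_cases hx : 0 < u x
  · simp [hx]
  · simp [hx]

/-- The weak gradient vanishes almost everywhere on the zero set. -/
lemma IsWeakGradient.ae_eq_zero_of_eq_zero (hΩ : IsOpen Ω) (hu : IsWeakGradient Ω u G)
    (hui : IntegrableOn u Ω) (hGi : IntegrableOn G Ω) :
    ∀ᵐ x ∂volume.restrict Ω, u x = 0 → G x = 0 := by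
  -- Write `u = u⁺ - (-u)⁺`. The gradients found for both terms vanish on `{u = 0}`, and uniqueness
  -- identifies their difference with `G`.
  have h1 := hu.posPart hΩ hui hGi
  have h2 := (hu.smul (-1)).posPart hΩ (hui.smul (-1 : ℝ)) (hGi.smul (-1 : ℝ))
  have h3 := (h1.sub h2).ae_unique hΩ hu (Eventually.of_forall fun x => by
    simp only [Pi.sub_apply, Pi.smul_apply, smul_eq_mul]
    rcases le_total 0 (u x) with h | h
    · rw [max_eq_left h, max_eq_right (by linarith)]; ring
    · rw [max_eq_right h, max_eq_left (by linarith)]; ring)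
  filter_upwards [h3] with x hx h0
  rw [← hx]
  simp [h0]

/-! ### Extension by zero -/

lemma exists_cutoff {K : Set (E N)} (hΩ : IsOpen Ω) (hK : IsCompact K) (hKΩ : K ⊆ Ω) :
    ∃ χ : E N → ℝ, IsTestFunction Ω χ ∧ ∀ x ∈ K, ∀ᶠ y in 𝓝 x, χ y = 1 := by
  obtain ⟨δ, hδ, hδΩ⟩ := hK.exists_cthickening_subset_open hΩ hKΩ
  have hint : K ⊆ interior (Metric.cthickening δ K) :=
    (Metric.self_subset_thickening hδ K).trans
      (interior_maximal (Metric.thickening_subset_cthickening δ K) Metric.isOpen_thickening)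
  obtain ⟨f, h1, h2, -⟩ := exists_contMDiffMap_one_nhds_of_subset_interior
    (modelWithCornersSelf ℝ (E N)) (n := ⊤) hK.isClosed hint
  have hs : tsupport f ⊆ Metric.cthickening δ K := by
    refine closure_minimal (fun x hx => ?_) Metric.isClosed_cthickening
    by_contra h
    exact hx (h2 x h)
  exact ⟨f, ⟨f.contMDiff.contDiff, hK.cthickening.of_isClosed_subset (isClosed_tsupport _) hs,
    hs.trans hδΩ⟩, fun x hx => eventually_nhdsSet_iff_forall.1 h1 x hx⟩

/-- Integration by parts of a compactly supported function against an arbitrary smooth function. -/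
lemma IsWeakGradient.integral_of_hasCompactSupport (hΩ : IsOpen Ω) (hu : IsWeakGradient Ω u G)
    (hc : HasCompactSupport u) (hs : tsupport u ⊆ Ω) {ψ : E N → ℝ} (hψ : ContDiff ℝ ∞ ψ)
    (i : Fin N) :
    ∫ x in Ω, u x * fderiv ℝ ψ x (EuclideanSpace.single i 1) = -∫ x in Ω, G x i * ψ x := by
  obtain ⟨χ, hχ, hχ1⟩ := exists_cutoff hΩ hc.isCompact hs
  have hχψ : IsTestFunction Ω (fun x => χ x * ψ x) :=
    ⟨hχ.1.mul hψ, hχ.2.1.mul_right, (tsupport_mul_subset_left (f := χ)).trans hχ.2.2⟩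
  -- Locality: on the open set `Ω \ tsupport u` the function is zero, hence so is its gradient. The
  -- cutoff `χ` therefore changes neither integral.
  have hG0 : ∀ᵐ x ∂volume.restrict Ω, x ∉ tsupport u → G x = 0 := by
    have ho : IsOpen (Ω \ tsupport u) := hΩ.sdiff (isClosed_tsupport u)
    have h := (hu.mono Set.sdiff_subset).ae_unique ho isWeakGradient_zero
      ((ae_restrict_mem ho.measurableSet).mono fun x hx =>
        image_eq_zero_of_notMem_tsupport hx.2)
    rw [EventuallyEq, ae_restrict_iff' ho.measurableSet] at h
    rw [ae_restrict_iff' hΩ.measurableSet]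
    filter_upwards [h] with x hx hxΩ hxu
    exact hx ⟨hxΩ, hxu⟩
  have e1 : ∫ x in Ω, u x * fderiv ℝ ψ x (EuclideanSpace.single i 1)
      = ∫ x in Ω, u x * fderiv ℝ (fun x => χ x * ψ x) x (EuclideanSpace.single i 1) := by
    refine integral_congr_ae (Eventually.of_forall fun x => ?_)
    simp only
    by_cases hx : x ∈ tsupport u
    · have : (fun x => χ x * ψ x) =ᶠ[𝓝 x] ψ := (hχ1 x hx).mono fun y hy => by simp [hy]
      rw [this.fderiv_eq]
    · simp [image_eq_zero_of_notMem_tsupport hx]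
  have e2 : ∫ x in Ω, G x i * ψ x = ∫ x in Ω, G x i * (χ x * ψ x) := by
    refine integral_congr_ae (hG0.mono fun x hx => ?_)
    simp only
    by_cases hxu : x ∈ tsupport u
    · rw [(hχ1 x hxu).self_of_nhds, one_mul]
    · simp [hx hxu]
  rw [e1, e2, hu.2.2 _ hχψ i]

/-- Integration by parts of an element of `W_0^{1,p(x)}(Ω)` against a test function of `ℝ^N`. -/
lemma IsApproxSeq.integral_eq (hp : IsExponent p Ω) (hΩ : IsOpen Ω)
    (hb : Bornology.IsBounded Ω) {φ : ℕ → E N → ℝ} {Γ : ℕ → E N → E N}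
    (h : IsApproxSeq p Ω u G φ Γ) (hu : HasSobolevGrad p Ω u G) {ψ : E N → ℝ}
    (hψ : IsTestFunction Set.univ ψ) (i : Fin N) :
    ∫ x in Ω, u x * fderiv ℝ ψ x (EuclideanSpace.single i 1) = -∫ x in Ω, G x i * ψ x := by
  set e : E N := EuclideanSpace.single i 1
  obtain ⟨C₁, hC₁⟩ := (hψ.hasCompactSupport_fderiv_apply e).exists_bound_of_continuous
    (hψ.continuous_fderiv_apply e)
  obtain ⟨C₂, hC₂⟩ := hψ.2.1.exists_bound_of_continuous hψ.1.continuous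
  have hproj : ∀ {V : E N → E N}, IntegrableOn V Ω → IntegrableOn (fun x => V x i) Ω :=
    fun hV => (EuclideanSpace.proj (𝕜 := ℝ) i).integrable_comp hV
  have t1 : Tendsto (fun n => ∫ x in Ω, φ n x * fderiv ℝ ψ x e) atTop
      (𝓝 (∫ x in Ω, u x * fderiv ℝ ψ x e)) :=
    tendsto_integral_mul_of_L1 (b := fun _ x => fderiv ℝ ψ x e)
      (fun n => (h.grad n).integrableOn hp hΩ hb) (hu.integrableOn hp hΩ hb)
      (tendsto_lintegral_enorm_of_modular hp hΩ hb h.tendsto_fun)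
      (fun n => (hψ.continuous_fderiv_apply e).aestronglyMeasurable) (fun _ => hC₁)
      (Eventually.of_forall fun x => tendsto_const_nhds)
  have t2 : Tendsto (fun n => ∫ x in Ω, Γ n x i * ψ x) atTop (𝓝 (∫ x in Ω, G x i * ψ x)) := by
    refine tendsto_integral_mul_of_L1 (b := fun _ x => ψ x)
      (fun n => hproj ((h.grad n).integrableOn_grad hp hΩ hb))
      (hproj (hu.integrableOn_grad hp hΩ hb)) ?_
      (fun n => hψ.1.continuous.aestronglyMeasurable) (fun _ => hC₂)
      (Eventually.of_forall fun x => tendsto_const_nhds)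
    refine tendsto_of_tendsto_of_tendsto_of_le_of_le tendsto_const_nhds
      (tendsto_lintegral_enorm_of_modular hp hΩ hb h.tendsto_grad)
      (fun _ => zero_le) fun n => lintegral_mono fun x => ?_
    exact enorm_le_iff_norm_le.2 (PiLp.norm_apply_le (Γ n x - G x) i)
  refine tendsto_nhds_unique t1 (t2.neg.congr fun n => ?_)
  exact ((h.grad n).weak.integral_of_hasCompactSupport hΩ (h.compact n) (h.tsupport_subset n)
    hψ.1 i).symm

lemma integrableOn_of_eq_zero {F : Type*} [NormedAddCommGroup F] {g : E N → F}
    (hg : IntegrableOn g Ω) (h0 : ∀ x ∉ Ω, g x = 0) : IntegrableOn g Ω' := by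
  rw [integrableOn_iff_integrable_of_support_subset] at hg
  · exact hg.integrableOn
  · intro x hx
    by_contra h
    exact hx (h0 x h)

/-- Extension by zero, for functions that can be integrated by parts without boundary term. -/
lemma HasSobolevGrad.extend (hp : IsExponent p Ω') (hΩ : IsOpen Ω) (hΩ' : IsOpen Ω')
    (hb : Bornology.IsBounded Ω) (hs : Ω ⊆ Ω') (hu : HasSobolevGrad p Ω u G)
    (h0 : ∀ x ∉ Ω, u x = 0)
    (h : ∀ ψ, IsTestFunction Set.univ ψ → ∀ i,
      ∫ x in Ω, u x * fderiv ℝ ψ x (EuclideanSpace.single i 1) = -∫ x in Ω, G x i * ψ x) :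
    HasSobolevGrad p Ω' u (Ω.indicator G) := by
  have hpΩ := hp.mono hs
  have hG0 : ∀ x ∉ Ω, Ω.indicator G x = 0 := fun x hx => Set.indicator_of_notMem hx G
  have hGΩ : IntegrableOn (Ω.indicator G) Ω :=
    (hu.integrableOn_grad hpΩ hΩ hb).congr_fun
      (fun x hx => (Set.indicator_of_mem hx G).symm) hΩ.measurableSet
  have hu0 : Ω.indicator u = u := Set.indicator_eq_self.2 fun x hx => by
    by_contra hxΩ
    exact hx (h0 x hxΩ)
  refine ⟨⟨IntegrableOn.locallyIntegrableOn
      (integrableOn_of_eq_zero (hu.integrableOn hpΩ hΩ hb) h0),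
    IntegrableOn.locallyIntegrableOn (integrableOn_of_eq_zero hGΩ hG0), fun ψ hψ i => ?_⟩, ?_, ?_⟩
  · have z1 : ∀ x ∉ Ω, u x * fderiv ℝ ψ x (EuclideanSpace.single i 1) = 0 := fun x hx => by
      rw [h0 x hx, zero_mul]
    have z2 : ∀ x ∉ Ω, Ω.indicator G x i * ψ x = 0 := fun x hx => by rw [hG0 x hx]; simp
    rw [setIntegral_eq_integral_of_forall_compl_eq_zero fun x hx => z1 x fun h => hx (hs h),
      setIntegral_eq_integral_of_forall_compl_eq_zero fun x hx => z2 x fun h => hx (hs h),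
      ← setIntegral_eq_integral_of_forall_compl_eq_zero z1,
      ← setIntegral_eq_integral_of_forall_compl_eq_zero z2,
      h ψ (hψ.mono (Set.subset_univ _)) i]
    congr 1
    exact setIntegral_congr_fun hΩ.measurableSet fun x hx => by
      simp only [Set.indicator_of_mem hx]
  · rw [← hu0, modular_indicator hp hΩ hΩ' hs]; exact hu.fun_lt_top
  · rw [modular_indicator hp hΩ hΩ' hs]; exact hu.grad_lt_top

lemma eq_zero_of_tsupport_subset (hs : tsupport u ⊆ Ω) : ∀ x ∉ Ω, u x = 0 :=
  fun _ hx => image_eq_zero_of_notMem_tsupport fun h => hx (hs h)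

/-- `W_0^{1,p(x)}(Ω) ⊆ W_0^{1,p(x)}(Ω')` for `Ω ⊆ Ω'`. -/
lemma MemSobolevZero.extend (hp : IsExponent p Ω') (hΩ : IsOpen Ω) (hΩ' : IsOpen Ω')
    (hb : Bornology.IsBounded Ω) (hs : Ω ⊆ Ω') (hu : MemSobolevZero p Ω u)
    (hG : HasSobolevGrad p Ω u G) :
    MemSobolevZero p Ω' u ∧ HasSobolevGrad p Ω' u (Ω.indicator G) := by
  have hpΩ := hp.mono hs
  obtain ⟨φ, Γ, h⟩ := hu.exists_isApproxSeq hpΩ hΩ hG.weak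
  have hext : HasSobolevGrad p Ω' u (Ω.indicator G) :=
    hG.extend hp hΩ hΩ' hb hs hu.1 fun ψ hψ i => h.integral_eq hpΩ hΩ hb hG hψ i
  refine ⟨?_, hext⟩
  have hφ0 : ∀ n, ∀ x ∉ Ω, φ n x = 0 := fun n => eq_zero_of_tsupport_subset (h.tsupport_subset n)
  have happ : IsApproxSeq p Ω' u (Ω.indicator G) φ (fun n => Ω.indicator (Γ n)) := by
    refine ⟨fun n => ?_, h.compact, fun n => (h.tsupport_subset n).trans hs, ?_, ?_⟩
    · exact (h.grad n).extend hp hΩ hΩ' hb hs (hφ0 n) fun ψ hψ i =>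
        (h.grad n).weak.integral_of_hasCompactSupport hΩ (h.compact n) (h.tsupport_subset n) hψ.1 i
    · refine h.tendsto_fun.congr fun n => ?_
      rw [← modular_indicator hp hΩ hΩ' hs, Set.indicator_eq_self.2]
      intro x hx
      by_contra hxΩ
      exact hx (by simp [hφ0 n x hxΩ, hu.1 x hxΩ])
    · refine h.tendsto_grad.congr fun n => ?_
      rw [← modular_indicator hp hΩ hΩ' hs, Set.indicator_sub']
  exact happ.memSobolevZero hp hΩ' hext fun x hx => hu.1 x fun h => hx (hs h)

/-! ### Functions with vanishing gradient -/

/-- Pair `u` with translates of `g` along one coordinate axis. The pairing is constant in the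
translation parameter and vanishes once the support of `g` has left the bounded set `Ω`. Translates
leave `Ω` on the way, which is why the hypothesis concerns test functions of the whole space. -/
lemma ae_eq_zero_of_integral_fderiv_eq_zero (hN : 1 ≤ N) (hΩ : IsOpen Ω)
    (hb : Bornology.IsBounded Ω) (hu : IntegrableOn u Ω)
    (h : ∀ ψ, IsTestFunction Set.univ ψ → ∀ i,
      ∫ x in Ω, u x * fderiv ℝ ψ x (EuclideanSpace.single i 1) = 0) :
    ∀ᵐ x ∂volume.restrict Ω, u x = 0 := by
  rw [ae_restrict_iff' hΩ.measurableSet]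
  refine hΩ.ae_eq_zero_of_integral_contDiff_smul_eq_zero hu.locallyIntegrableOn ?_
  intro g hg hgc hgs
  set i : Fin N := ⟨0, hN⟩
  set e : E N := EuclideanSpace.single i 1 with he
  have hgt : IsTestFunction Ω g := ⟨hg, hgc, hgs⟩
  have hshift : ∀ t : ℝ, IsTestFunction Set.univ (fun x => g (x + t • e)) := fun t =>
    ⟨hg.comp (contDiff_id.add (contDiff_const (c := t • e))), hgc.comp_homeomorph (Homeomorph.addRight (t • e)),
      Set.subset_univ _⟩
  obtain ⟨C, hC⟩ := (hgt.hasCompactSupport_fderiv_apply e).exists_bound_of_continuous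
    (hgt.continuous_fderiv_apply e)
  obtain ⟨C₀, hC₀⟩ := hgc.exists_bound_of_continuous hg.continuous
  have hd : ∀ t : ℝ, HasDerivAt (fun t : ℝ => ∫ x in Ω, u x * g (x + t • e)) 0 t := by
    intro t
    have hcs : ∀ t : ℝ, Continuous (fun x => g (x + t • e)) := fun t => (hshift t).1.continuous
    have hcd : Continuous (fun x => fderiv ℝ g (x + t • e) e) :=
      (hgt.continuous_fderiv_apply e).comp (by fun_prop : Continuous fun x : E N => x + t • e)
    have key := (hasDerivAt_integral_of_dominated_loc_of_deriv_le (μ := volume.restrict Ω)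
      (F := fun t x => u x * g (x + t • e)) (F' := fun t x => u x * fderiv ℝ g (x + t • e) e)
      (x₀ := t) (s := Set.univ) (bound := fun x => ‖u x‖ * C) univ_mem
      (Eventually.of_forall fun t => hu.1.mul (hcs t).aestronglyMeasurable)
      (hu.mul_bdd (hcs t).aestronglyMeasurable (Eventually.of_forall fun x => hC₀ _))
      (hu.1.mul hcd.aestronglyMeasurable)
      (Eventually.of_forall fun x s _ => by
        rw [norm_mul]
        exact mul_le_mul_of_nonneg_left (hC _) (norm_nonneg _))
      (hu.norm.mul_const C)
      (Eventually.of_forall fun x s _ => by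
        refine HasDerivAt.const_mul _ ?_
        have h1 : HasFDerivAt g (fderiv ℝ g (x + s • e)) (x + s • e) :=
          (hg.differentiable (by simp) _).hasFDerivAt
        have h2 : HasDerivAt (fun s : ℝ => x + s • e) e s := by
          simpa using ((hasDerivAt_id s).smul_const e).const_add x
        exact h1.comp_hasDerivAt s h2)).2
    have hz : ∫ x in Ω, u x * fderiv ℝ g (x + t • e) e = 0 := by
      rw [← h _ (hshift t) i]
      refine integral_congr_ae (Eventually.of_forall fun x => ?_)
      simp only
      rw [fderiv_comp_add_right]
    rwa [hz] at key
  obtain ⟨R, hR⟩ := hb.exists_norm_le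
  obtain ⟨S, hS⟩ := hgc.isCompact.isBounded.exists_norm_le
  -- The shift is longer than the sum of the bounds for `Ω` and for the support of `g`. Absolute
  -- values appear because the bounds carry no sign information.
  have hfar : ∫ x in Ω, u x * g (x + (|R| + |S| + 1) • e) = 0 := by
    rw [setIntegral_congr_fun (g := fun _ => (0 : ℝ)) hΩ.measurableSet]
    · simp
    · intro x hx
      have : x + (|R| + |S| + 1) • e ∉ tsupport g := by
        intro hmem
        have h1 := hS _ hmem
        have h2 := hR x hx
        have h3 : ‖(|R| + |S| + 1) • e‖ = |R| + |S| + 1 := by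
          rw [norm_smul, he, PiLp.norm_single, norm_one, mul_one,
            Real.norm_of_nonneg (by positivity)]
        have h4 : ‖(|R| + |S| + 1) • e‖ ≤ ‖x + (|R| + |S| + 1) • e‖ + ‖x‖ := by
          simpa using norm_sub_le (x + (|R| + |S| + 1) • e) x
        linarith [le_abs_self R, le_abs_self S]
      simp only
      rw [image_eq_zero_of_notMem_tsupport this, mul_zero]
  have hconst := is_const_of_deriv_eq_zero (f := fun t : ℝ => ∫ x in Ω, u x * g (x + t • e))
    (fun t => (hd t).differentiableAt) (fun t => (hd t).deriv) 0 (|R| + |S| + 1)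
  simp only [zero_smul, add_zero] at hconst
  rw [hfar] at hconst
  rw [← hconst, ← setIntegral_eq_integral_of_forall_compl_eq_zero (s := Ω)]
  · exact integral_congr_ae (Eventually.of_forall fun x => by simp only [smul_eq_mul]; ring)
  · intro x hx
    rw [eq_zero_of_tsupport_subset hgs x hx, zero_smul]

/-- An element of `W_0^{1,p(x)}(Ω)` with vanishing gradient vanishes. -/
lemma MemSobolevZero.ae_eq_zero (hN : 1 ≤ N) (hp : IsExponent p Ω) (hΩ : IsOpen Ω)
    (hb : Bornology.IsBounded Ω) (hu : MemSobolevZero p Ω u) (hG : HasSobolevGrad p Ω u G)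
    (h0 : ∀ᵐ x ∂volume.restrict Ω, G x = 0) : ∀ᵐ x ∂volume.restrict Ω, u x = 0 := by
  obtain ⟨φ, Γ, h⟩ := hu.exists_isApproxSeq hp hΩ hG.weak
  refine ae_eq_zero_of_integral_fderiv_eq_zero hN hΩ hb (hG.integrableOn hp hΩ hb)
    fun ψ hψ i => ?_
  rw [h.integral_eq hp hΩ hb hG hψ i, neg_eq_zero]
  exact integral_eq_zero_of_ae (h0.mono fun x hx => by simp [hx])

/-! ### Positive parts in `W_0^{1,p(x)}` -/

lemma HasSobolevGrad.nullMeasurableSet_pos (hu : HasSobolevGrad p Ω u G) :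
    NullMeasurableSet {x | 0 < u x} (volume.restrict Ω) :=
  nullMeasurableSet_lt aemeasurable_const hu.aestronglyMeasurable.aemeasurable

lemma HasSobolevGrad.posPart (hp : IsExponent p Ω) (hΩ : IsOpen Ω) (hb : Bornology.IsBounded Ω)
    (hu : HasSobolevGrad p Ω u G) :
    HasSobolevGrad p Ω (fun x => max (u x) 0) ({x | 0 < u x}.indicator G) := by
  refine ⟨hu.weak.posPart hΩ (hu.integrableOn hp hΩ hb) (hu.integrableOn_grad hp hΩ hb), ?_, ?_⟩
  · refine (modular_mono hp hΩ (Eventually.of_forall fun x => ?_)).trans_lt hu.fun_lt_top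
    simpa using abs_max_sub_max_le_abs (u x) 0 0
  · exact (modular_mono hp hΩ (Eventually.of_forall fun x =>
      norm_indicator_le_norm_self _ _)).trans_lt hu.grad_lt_top

/-- The positive part is continuous on `W^{1,p(x)}(Ω)`, up to passing to a subsequence. -/
lemma exists_tendsto_modular_posPart (hp : IsExponent p Ω) (hΩ : IsOpen Ω)
    (hb : Bornology.IsBounded Ω) {h : ℕ → E N → ℝ} {V : ℕ → E N → E N}
    (hh : ∀ n, HasSobolevGrad p Ω (h n) (V n)) (hu : HasSobolevGrad p Ω u G)
    (h1 : Tendsto (fun n => modular p Ω (h n - u)) atTop (𝓝 0))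
    (h2 : Tendsto (fun n => modular p Ω (V n - G)) atTop (𝓝 0)) :
    ∃ ns : ℕ → ℕ,
      Tendsto (fun n => modular p Ω ((fun x => max (h (ns n) x) 0) - fun x => max (u x) 0))
        atTop (𝓝 0) ∧
      Tendsto (fun n => modular p Ω ({x | 0 < h (ns n) x}.indicator (V (ns n)) -
        {x | 0 < u x}.indicator G)) atTop (𝓝 0) := by
  obtain ⟨P, hP0, hP⟩ := hp.exists_bound
  have hmeas : TendstoInMeasure (volume.restrict Ω) h atTop u := by
    refine tendstoInMeasure_of_tendsto_eLpNorm (p := 1) one_ne_zero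
      (fun n => (hh n).aestronglyMeasurable) hu.aestronglyMeasurable ?_
    simp only [eLpNorm_one_eq_lintegral_enorm]
    exact tendsto_lintegral_enorm_of_modular hp hΩ hb h1
  obtain ⟨ns, hns, hae⟩ := hmeas.exists_seq_tendsto_ae
  refine ⟨ns, ?_, ?_⟩
  · refine tendsto_of_tendsto_of_tendsto_of_le_of_le tendsto_const_nhds
      (h1.comp hns.tendsto_atTop) (fun _ => zero_le) fun n => ?_
    exact modular_mono hp hΩ (Eventually.of_forall fun x => abs_max_sub_max_le_abs _ _ _)
  -- `A` carries the convergence of the gradients and `D` that of the positivity sets. The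
  -- indicators in `D` may fail to converge only where `u = 0`, and there `G = 0` a.e.
  · set A : ℕ → E N → E N := fun n => {x | 0 < h (ns n) x}.indicator (V (ns n) - G)
    set D : ℕ → E N → E N := fun n => {x | 0 < h (ns n) x}.indicator G - {x | 0 < u x}.indicator G
    have hA : ∀ n, AEStronglyMeasurable (A n) (volume.restrict Ω) := fun n =>
      ((hh (ns n)).aestronglyMeasurable_grad.sub hu.aestronglyMeasurable_grad).indicator₀
        (hh (ns n)).nullMeasurableSet_pos
    have hD : ∀ n, AEStronglyMeasurable (D n) (volume.restrict Ω) := fun n =>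
      (hu.aestronglyMeasurable_grad.indicator₀ (hh (ns n)).nullMeasurableSet_pos).sub
        (hu.aestronglyMeasurable_grad.indicator₀ hu.nullMeasurableSet_pos)
    have hAD : ∀ n, {x | 0 < h (ns n) x}.indicator (V (ns n)) - {x | 0 < u x}.indicator G
        = A n + D n := fun n => by
      simp only [A, D, Set.indicator_sub']
      abel
    have tA : Tendsto (fun n => modular p Ω (A n)) atTop (𝓝 0) :=
      tendsto_of_tendsto_of_tendsto_of_le_of_le tendsto_const_nhds
        (h2.comp hns.tendsto_atTop) (fun _ => zero_le) fun n =>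
        modular_mono hp hΩ (Eventually.of_forall fun x => norm_indicator_le_norm_self _ _)
    have tD : Tendsto (fun n => modular p Ω (D n)) atTop (𝓝 0) := by
      have := tendsto_lintegral_of_dominated_convergence' (μ := volume.restrict Ω)
        (F := fun n x => ‖D n x‖ₑ ^ p x) (f := fun _ => 0) (fun x => ‖G x‖ₑ ^ p x)
        (fun n => hp.aemeasurable_enorm_rpow hΩ (hD n)) (fun n => ?_) hu.grad_lt_top.ne ?_
      · simpa [modular] using this
      · filter_upwards [ae_restrict_mem hΩ.measurableSet] with x hx
        refine ENNReal.rpow_le_rpow (enorm_le_iff_norm_le.2 ?_)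
          (zero_le_one.trans (hp.one_le x hx))
        simp only [D, Pi.sub_apply, Set.indicator, Set.mem_ofPred_eq]
        split_ifs <;> simp
      · filter_upwards [hae, ae_restrict_mem hΩ.measurableSet,
          hu.weak.ae_eq_zero_of_eq_zero hΩ (hu.integrableOn hp hΩ hb)
            (hu.integrableOn_grad hp hΩ hb)] with x hx hxΩ hx0
        have hz : ∀ᶠ n in atTop, D n x = 0 := by
          rcases lt_trichotomy (u x) 0 with hlt | heq | hgt
          · filter_upwards [hx.eventually (gt_mem_nhds hlt)] with n hn
            simp [D, not_lt.2 hlt.le, not_lt.2 hn.le]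
          · refine Eventually.of_forall fun n => ?_
            simp [D, Set.indicator, hx0 heq]
          · filter_upwards [hx.eventually (lt_mem_nhds hgt)] with n hn
            simp [D, hgt, hn]
        refine tendsto_const_nhds.congr' (hz.mono fun n hn => ?_)
        simp only
        rw [hn, enorm_zero, ENNReal.zero_rpow_of_pos (zero_lt_one.trans_le (hp.one_le x hxΩ))]
    have tAD := ENNReal.Tendsto.const_mul (a := 2 ^ P) (tA.add tD)
      (Or.inr (ENNReal.rpow_ne_top_of_nonneg hP0 (by simp)))
    rw [add_zero, mul_zero] at tAD
    refine tendsto_of_tendsto_of_tendsto_of_le_of_le tendsto_const_nhds tAD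
      (fun _ => zero_le) fun n => ?_
    simp only
    rw [hAD]
    exact modular_add_le hp hΩ hP (hA n)

/-- If `u ∈ W_0^{1,p(x)}(Ω)` and `0 ≤ z ∈ W^{1,p(x)}(Ω)`, then `(u - z)⁺ ∈ W_0^{1,p(x)}(Ω)`. -/
lemma MemSobolevZero.posPart_sub (hp : IsExponent p Ω) (hΩ : IsOpen Ω)
    (hb : Bornology.IsBounded Ω) (hu : MemSobolevZero p Ω u) (hG : HasSobolevGrad p Ω u G)
    (hz : HasSobolevGrad p Ω z Z) (hz0 : ∀ᵐ x ∂volume.restrict Ω, 0 ≤ z x) :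
    MemSobolevZero p Ω (Ω.indicator fun x => max (u x - z x) 0) ∧
      HasSobolevGrad p Ω (Ω.indicator fun x => max (u x - z x) 0)
        ({x | 0 < u x - z x}.indicator (G - Z)) := by
  have hae : (fun x => max ((u - z) x) 0) =ᵐ[volume.restrict Ω]
      (Ω.indicator fun x => max (u x - z x) 0) :=
    (ae_restrict_mem hΩ.measurableSet).mono fun x hx => by simp [hx]
  have hw : HasSobolevGrad p Ω (Ω.indicator fun x => max (u x - z x) 0)
      ({x | 0 < u x - z x}.indicator (G - Z)) :=
    ((hG.sub hp hΩ hz).posPart hp hΩ hb).congr hΩ hae EventuallyEq.rfl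
  refine ⟨?_, hw⟩
  obtain ⟨φ, Γ, h⟩ := hu.exists_isApproxSeq hp hΩ hG.weak
  obtain ⟨ns, t1, t2⟩ := exists_tendsto_modular_posPart hp hΩ hb
    (fun n => (h.grad n).sub hp hΩ hz) (hG.sub hp hΩ hz)
    (h.tendsto_fun.congr fun n => by rw [sub_sub_sub_cancel_right])
    (h.tendsto_grad.congr fun n => by rw [sub_sub_sub_cancel_right])
  set K : ℕ → Set (E N) := fun n => tsupport (φ (ns n))
  -- Off `K n` the positive part is `(-z)⁺`, which is zero a.e. since `z ≥ 0`. The indicator makes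
  -- this hold everywhere, so that the topological support is really compact.
  set w : ℕ → E N → ℝ := fun n => (K n).indicator fun x => max (φ (ns n) x - z x) 0
  have hwae : ∀ n, (fun x => max ((φ (ns n) - z) x) 0) =ᵐ[volume.restrict Ω] w n := fun n =>
    hz0.mono fun x hx => by
      by_cases hxK : x ∈ K n
      · simp [w, hxK]
      · simp [w, hxK, image_eq_zero_of_notMem_tsupport hxK, hx]
  have hts : ∀ n, tsupport (w n) ⊆ K n := fun n =>
    closure_minimal Set.support_indicator_subset (isClosed_tsupport _)
  have happ : IsApproxSeq p Ω (Ω.indicator fun x => max (u x - z x) 0)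
      ({x | 0 < u x - z x}.indicator (G - Z)) w
      (fun n => {x | 0 < (φ (ns n) - z) x}.indicator (Γ (ns n) - Z)) := by
    refine ⟨fun n => ?_, fun n => ?_, fun n => ?_, ?_, t2⟩
    · exact (((h.grad (ns n)).sub hp hΩ hz).posPart hp hΩ hb).congr hΩ (hwae n) EventuallyEq.rfl
    · exact (h.compact (ns n)).of_isClosed_subset (isClosed_tsupport _) (hts n)
    · exact (hts n).trans (h.tsupport_subset (ns n))
    · exact t1.congr fun n => modular_congr ((hwae n).sub hae)
  exact happ.memSobolevZero hp hΩ hw fun x hx => Set.indicator_of_notMem hx _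

lemma MemSobolevZero.smul (hp : IsExponent p Ω) (hΩ : IsOpen Ω) (c : ℝ)
    (hu : MemSobolevZero p Ω u) : MemSobolevZero p Ω (c • u) := by
  have hG := hu.2.1.hasSobolevGrad
  obtain ⟨P, hP0, hP⟩ := hp.exists_bound
  obtain ⟨φ, Γ, h⟩ := hu.exists_isApproxSeq hp hΩ hG.weak
  have bound : ∃ C : ℝ≥0∞, C ≠ ⊤ ∧ ∀ x ∈ Ω, ‖c‖ₑ ^ p x ≤ C := by
    refine ⟨max 1 ‖c‖ₑ ^ P, ENNReal.rpow_ne_top_of_nonneg hP0 (by simp), fun x hx => ?_⟩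
    exact (ENNReal.rpow_le_rpow (le_max_right _ _) (zero_le_one.trans (hp.one_le x hx))).trans
      (ENNReal.rpow_le_rpow_of_exponent_le (le_max_left _ _) (hP x hx))
  obtain ⟨C, hC, hcC⟩ := bound
  have key : ∀ {F : Type} [NormedAddCommGroup F] [NormedSpace ℝ F] {f : ℕ → E N → F}
      {g : E N → F}, Tendsto (fun n => modular p Ω (f n - g)) atTop (𝓝 0) →
      Tendsto (fun n => modular p Ω (c • f n - c • g)) atTop (𝓝 0) := by
    intro F _ _ f g hfg
    have t := ENNReal.Tendsto.const_mul (a := C) hfg (Or.inr hC)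
    rw [mul_zero] at t
    refine tendsto_of_tendsto_of_tendsto_of_le_of_le tendsto_const_nhds t
      (fun _ => zero_le) fun n => ?_
    simp only
    rw [← smul_sub]
    exact modular_smul_le_of_forall hp hΩ hC hcC
  refine IsApproxSeq.memSobolevZero (φ := fun n => c • φ n) (Γ := fun n => c • Γ n) hp hΩ
    ⟨fun n => (h.grad n).smul hp hΩ c, fun n => ?_, fun n => ?_, key h.tendsto_fun,
      key h.tendsto_grad⟩ (hG.smul hp hΩ c) fun x hx => by simp [hu.1 x hx]
  · exact (h.compact n).of_isClosed_subset (isClosed_tsupport _)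
      (tsupport_smul_subset_right (fun _ => c) (φ n))
  · exact (tsupport_smul_subset_right (fun _ => c) (φ n)).trans (h.tsupport_subset n)

/-! ### Strict monotonicity of the flux -/

lemma rpow_sub_two_mul_self {q r : ℝ} (hq : 1 < q) (hr : 0 ≤ r) :
    r ^ (q - 2) * r = r ^ (q - 1) := by
  rcases hr.eq_or_lt with rfl | h
  · rw [mul_zero, Real.zero_rpow (by linarith)]
  · rw [← Real.rpow_add_one h.ne']; congr 1; ring

section Inner

variable {W : Type*} [NormedAddCommGroup W] [InnerProductSpace ℝ W] {q : ℝ}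

/-- Expand and apply Cauchy–Schwarz to the mixed terms. This reduces monotonicity of the flux to
that of `t ↦ t ^ (q - 1)`. -/
lemma flux_inner_sub_lower_bound (hq : 1 < q) (a b : W) :
    (‖a‖ ^ (q - 1) - ‖b‖ ^ (q - 1)) * (‖a‖ - ‖b‖) ≤
      ‖a‖ ^ (q - 2) * inner ℝ a (a - b) - ‖b‖ ^ (q - 2) * inner ℝ b (a - b) := by
  have hab := real_inner_le_norm a b
  have ha := rpow_sub_two_mul_self hq (norm_nonneg a)
  have hb := rpow_sub_two_mul_self hq (norm_nonneg b)
  have ha0 : 0 ≤ ‖a‖ ^ (q - 2) := by positivity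
  have hb0 : 0 ≤ ‖b‖ ^ (q - 2) := by positivity
  rw [inner_sub_right, inner_sub_right, real_inner_self_eq_norm_sq, real_inner_self_eq_norm_sq,
    real_inner_comm a b, ← ha, ← hb]
  nlinarith [mul_le_mul_of_nonneg_left hab (add_nonneg ha0 hb0)]

lemma flux_inner_sub_nonneg (hq : 1 < q) (a b : W) :
    0 ≤ ‖a‖ ^ (q - 2) * inner ℝ a (a - b) - ‖b‖ ^ (q - 2) * inner ℝ b (a - b) := by
  refine le_trans ?_ (flux_inner_sub_lower_bound hq a b)
  rcases le_total ‖a‖ ‖b‖ with h | h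
  · exact mul_nonneg_of_nonpos_of_nonpos
      (sub_nonpos.2 (Real.rpow_le_rpow (norm_nonneg _) h (by linarith))) (sub_nonpos.2 h)
  · exact mul_nonneg
      (sub_nonneg.2 (Real.rpow_le_rpow (norm_nonneg _) h (by linarith))) (sub_nonneg.2 h)

/-- Strict monotonicity of `t ↦ t ^ (q - 1)` first forces equal norms; the expression then becomes
`‖b‖ ^ (q - 2) * ‖a - b‖ ^ 2`. -/
lemma eq_of_flux_inner_sub_eq_zero (hq : 1 < q) {a b : W}
    (h : ‖a‖ ^ (q - 2) * inner ℝ a (a - b) - ‖b‖ ^ (q - 2) * inner ℝ b (a - b) = 0) : a = b := by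
  have hle := (flux_inner_sub_lower_bound hq a b).trans h.le
  have hnorm : ‖a‖ = ‖b‖ := by
    rcases lt_trichotomy ‖a‖ ‖b‖ with hl | he | hl
    · have h1 := Real.rpow_lt_rpow (norm_nonneg _) hl (by linarith : 0 < q - 1)
      nlinarith [mul_pos (sub_pos.2 h1) (sub_pos.2 hl)]
    · exact he
    · have h1 := Real.rpow_lt_rpow (norm_nonneg _) hl (by linarith : 0 < q - 1)
      nlinarith [mul_pos (sub_pos.2 h1) (sub_pos.2 hl)]
  rw [hnorm, ← mul_sub, ← inner_sub_left, real_inner_self_eq_norm_sq] at h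
  rcases (norm_nonneg b).eq_or_lt with h0 | h0
  · rw [← h0, norm_eq_zero] at hnorm
    rw [hnorm, norm_eq_zero.1 h0.symm]
  · rcases mul_eq_zero.1 h with h1 | h1
    · exact absurd h1 (Real.rpow_pos_of_pos h0 _).ne'
    · exact sub_eq_zero.1 (norm_eq_zero.1 (pow_eq_zero_iff two_ne_zero |>.1 h1))

/-- With `M = max ‖a‖ ‖b‖` the left side is at most `M ^ q`. This crude form of Young's inequality
makes the flux pairing integrable. -/
lemma norm_flux_inner_le (hq : 1 < q) (a b : W) :
    ‖‖a‖ ^ (q - 2) * inner ℝ a b‖ ≤ ‖a‖ ^ q + ‖b‖ ^ q := by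
  rw [norm_mul, Real.norm_of_nonneg (by positivity)]
  calc ‖a‖ ^ (q - 2) * ‖inner ℝ a b‖ ≤ ‖a‖ ^ (q - 2) * (‖a‖ * ‖b‖) := by
        gcongr; exact norm_inner_le_norm a b
    _ = ‖a‖ ^ (q - 1) * ‖b‖ := by
        rw [← mul_assoc, rpow_sub_two_mul_self hq (norm_nonneg a)]
    _ ≤ max ‖a‖ ‖b‖ ^ (q - 1) * max ‖a‖ ‖b‖ := by
        have : 0 ≤ q - 1 := by linarith
        gcongr
        · exact le_max_left _ _
        · exact le_max_right _ _
    _ = max ‖a‖ ‖b‖ ^ q := by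
        rcases (le_max_of_le_left (norm_nonneg a) : 0 ≤ max ‖a‖ ‖b‖).eq_or_lt with h | h
        · rw [← h, mul_zero, Real.zero_rpow (by linarith)]
        · rw [← Real.rpow_add_one h.ne']; congr 1; ring
    _ ≤ ‖a‖ ^ q + ‖b‖ ^ q := by
        rcases max_choice ‖a‖ ‖b‖ with h | h <;> rw [h]
        · exact le_add_of_nonneg_right (by positivity)
        · exact le_add_of_nonneg_left (by positivity)

end Inner

lemma integrableOn_norm_rpow (hp : IsExponent p Ω) (hΩ : IsOpen Ω)
    (hG : AEStronglyMeasurable G (volume.restrict Ω)) (h : modular p Ω G < ⊤) :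
    IntegrableOn (fun x => ‖G x‖ ^ p x) Ω := by
  refine ⟨(hG.norm.aemeasurable.pow (hp.aemeasurable hΩ)).aestronglyMeasurable, ?_⟩
  refine lt_of_le_of_lt (setLIntegral_mono' hΩ.measurableSet fun x hx => ?_) h
  rw [Real.enorm_rpow_of_nonneg (norm_nonneg _) (zero_le_one.trans (hp.one_le x hx)), enorm_norm]

lemma integrableOn_flux_inner (hp : IsExponent p Ω) (hΩ : IsOpen Ω) (hp1 : ∀ x ∈ Ω, 1 < p x)
    (hG : AEStronglyMeasurable G (volume.restrict Ω)) (hGm : modular p Ω G < ⊤)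
    (hV : AEStronglyMeasurable V (volume.restrict Ω)) (hVm : modular p Ω V < ⊤) :
    IntegrableOn (fun x => ‖G x‖ ^ (p x - 2) * inner ℝ (G x) (V x)) Ω := by
  refine ((integrableOn_norm_rpow hp hΩ hG hGm).add (integrableOn_norm_rpow hp hΩ hV hVm)).mono'
    ?_ ?_
  · exact (hG.norm.aemeasurable.pow ((hp.aemeasurable hΩ).sub_const 2)).aestronglyMeasurable.mul
      (hG.inner hV)
  · filter_upwards [ae_restrict_mem hΩ.measurableSet] with x hx
    exact norm_flux_inner_le (hp1 x hx) (G x) (V x)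

/-- Weak comparison: if `0 ≤ z` and `-Δ_{p(x)} u ≤ -Δ_{p(x)} z` when tested with `(u - z)⁺`, then
`u ≤ z`. -/
lemma MemSobolevZero.ae_le (hN : 1 ≤ N) (hp : IsExponent p Ω) (hΩ : IsOpen Ω)
    (hb : Bornology.IsBounded Ω) (hp1 : ∀ x ∈ Ω, 1 < p x)
    (hu : MemSobolevZero p Ω u) (hG : HasSobolevGrad p Ω u G)
    (hz : HasSobolevGrad p Ω z Z) (hz0 : ∀ᵐ x ∂volume.restrict Ω, 0 ≤ z x)
    (hV : HasSobolevGrad p Ω (Ω.indicator fun x => max (u x - z x) 0) V)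
    (h : ∫ x in Ω, ‖G x‖ ^ (p x - 2) * inner ℝ (G x) (V x) ≤
      ∫ x in Ω, ‖Z x‖ ^ (p x - 2) * inner ℝ (Z x) (V x)) :
    ∀ᵐ x ∂volume.restrict Ω, u x ≤ z x := by
  obtain ⟨hw, hwV⟩ := hu.posPart_sub hp hΩ hb hG hz hz0
  have hVae := hV.weak.ae_unique hΩ hwV.weak EventuallyEq.rfl
  have iG := integrableOn_flux_inner hp hΩ hp1 hG.aestronglyMeasurable_grad hG.grad_lt_top
    hV.aestronglyMeasurable_grad hV.grad_lt_top
  have iZ := integrableOn_flux_inner hp hΩ hp1 hz.aestronglyMeasurable_grad hz.grad_lt_top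
    hV.aestronglyMeasurable_grad hV.grad_lt_top
  have hnonneg : ∀ᵐ x ∂volume.restrict Ω, 0 ≤ ‖G x‖ ^ (p x - 2) * inner ℝ (G x) (V x) -
      ‖Z x‖ ^ (p x - 2) * inner ℝ (Z x) (V x) := by
    filter_upwards [hVae, ae_restrict_mem hΩ.measurableSet] with x hx hxΩ
    rw [hx]
    by_cases hpos : 0 < u x - z x
    · rw [Set.indicator_of_mem (by exact hpos)]
      exact flux_inner_sub_nonneg (hp1 x hxΩ) _ _
    · rw [Set.indicator_of_notMem (by exact hpos)]
      simp
  have hzero : ∫ x in Ω, (‖G x‖ ^ (p x - 2) * inner ℝ (G x) (V x) -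
      ‖Z x‖ ^ (p x - 2) * inner ℝ (Z x) (V x)) = 0 := by
    -- The hypothesis on the fluxes bounds this integral above by zero, monotonicity bounds it
    -- below.
    refine le_antisymm ?_ (integral_nonneg_of_ae hnonneg)
    rw [integral_sub iG iZ]
    linarith
  have hae0 := (integral_eq_zero_iff_of_nonneg_ae hnonneg (iG.sub iZ)).1 hzero
  have hV0 : ∀ᵐ x ∂volume.restrict Ω, V x = 0 := by
    filter_upwards [hae0, hVae, ae_restrict_mem hΩ.measurableSet] with x h0 hx hxΩ
    rw [hx] at h0 ⊢
    by_cases hpos : 0 < u x - z x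
    · rw [Set.indicator_of_mem (by exact hpos)] at h0 ⊢
      exact sub_eq_zero.2 (eq_of_flux_inner_sub_eq_zero (hp1 x hxΩ) h0)
    · rw [Set.indicator_of_notMem (by exact hpos)]
  filter_upwards [hw.ae_eq_zero hN hp hΩ hb hV hV0, ae_restrict_mem hΩ.measurableSet]
    with x hx hxΩ
  rw [Set.indicator_of_mem hxΩ] at hx
  exact sub_nonpos.1 (hx ▸ le_max_left _ _)

lemma integral_flux_congr {G' V' : E N → E N} (hG : G =ᵐ[volume.restrict Ω] G')
    (hV : V =ᵐ[volume.restrict Ω] V') :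
    ∫ x in Ω, ‖G x‖ ^ (p x - 2) * inner ℝ (G x) (V x) =
      ∫ x in Ω, ‖G' x‖ ^ (p x - 2) * inner ℝ (G' x) (V' x) := by
  refine integral_congr_ae ?_
  filter_upwards [hG, hV] with x h1 h2
  rw [h1, h2]

/-- Weak maximum principle: solutions with a nonnegative right hand side are nonnegative. -/
lemma IsWeakSolution.ae_nonneg (hN : 1 ≤ N) (hp : IsExponent p Ω) (hΩ : IsOpen Ω)
    (hb : Bornology.IsBounded Ω) (hp1 : ∀ x ∈ Ω, 1 < p x) {f : (E N → ℝ) → ℝ}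
    (hf : IsNonnegFunctional p Ω f) (hu : IsWeakSolution p Ω f u) :
    ∀ᵐ x ∂volume.restrict Ω, 0 ≤ u x := by
  have hG := hu.1.2.1.hasSobolevGrad
  have hneg : MemSobolevZero p Ω ((-1 : ℝ) • u) := hu.1.smul hp hΩ (-1)
  have hnegG := hG.smul hp hΩ (-1)
  have h0 : HasSobolevGrad p Ω (0 : E N → ℝ) 0 := HasSobolevGrad.zero hp hΩ
  have h00 : ∀ᵐ x ∂volume.restrict Ω, (0 : ℝ) ≤ (0 : E N → ℝ) x :=
    Eventually.of_forall fun x => le_rfl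
  have hw := (hneg.posPart_sub hp hΩ hb hnegG h0 h00).1
  have hV := hw.2.1.hasSobolevGrad
  have hfw := hf _ hw (Eventually.of_forall fun x =>
    Set.indicator_nonneg (fun x _ => le_max_right _ _) x)
  rw [← hu.2 _ hw] at hfw
  -- Comparison of `-u` with `0`: the flux is odd, so its pairing for `-u` is `-⟨f, (-u)⁺⟩ ≤ 0`.
  have hle := hneg.ae_le hN hp hΩ hb hp1 hnegG h0 h00 hV (by
    have e : ∀ x, ‖((-1 : ℝ) • weakGrad Ω u) x‖ ^ (p x - 2) *
        inner ℝ (((-1 : ℝ) • weakGrad Ω u) x)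
          (weakGrad Ω (Ω.indicator fun x => max (((-1 : ℝ) • u) x - (0 : E N → ℝ) x) 0) x)
        = -(‖weakGrad Ω u x‖ ^ (p x - 2) * inner ℝ (weakGrad Ω u x)
          (weakGrad Ω (Ω.indicator fun x => max (((-1 : ℝ) • u) x - (0 : E N → ℝ) x) 0) x)) := by
      intro x
      rw [Pi.smul_apply, norm_smul, inner_smul_left]
      simp
    simp only [e, integral_neg]
    simpa using hfw)
  filter_upwards [hle] with x hx
  simp only [Pi.smul_apply, smul_eq_mul, Pi.zero_apply] at hx
  linarith

end VarExp

open VarExp in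
theorem mainTheorem8 (N : ℕ) (hN : 1 ≤ N)
    (Ω₁ Ω₂ : Set (VarExp.E N)) (hΩ₁ : IsOpen Ω₁) (hΩ₂ : IsOpen Ω₂)
    (hbdd : Bornology.IsBounded Ω₂) (hsub : Ω₁ ⊆ Ω₂)
    (p : VarExp.E N → ℝ) (hp : VarExp.IsExponent p Ω₂)
    (pmin : ℝ) (hpmin : 1 < pmin) (hp_min : ∀ x ∈ Ω₂, pmin ≤ p x)
    (f : (VarExp.E N → ℝ) → ℝ) (hf : VarExp.IsDualElement p Ω₂ f)
    (hf_nonneg : VarExp.IsNonnegFunctional p Ω₂ f)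
    (u₁ u₂ : VarExp.E N → ℝ)
    (hu₁ : VarExp.IsWeakSolution p Ω₁ f u₁) (hu₂ : VarExp.IsWeakSolution p Ω₂ f u₂) :
    ∀ᵐ x ∂(MeasureTheory.volume.restrict Ω₂), u₁ x ≤ u₂ x := by
  have hp1 : ∀ x ∈ Ω₂, 1 < p x := fun x hx => hpmin.trans_le (hp_min x hx)
  have hpΩ₁ := hp.mono hsub
  have hb₁ := hbdd.subset hsub
  have h2nonneg := hu₂.ae_nonneg hN hp hΩ₂ hbdd hp1 hf_nonneg
  have hG := hu₁.1.2.1.hasSobolevGrad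
  have hZ := hu₂.1.2.1.hasSobolevGrad
  have h2nonneg₁ := MeasureTheory.ae_restrict_of_ae_restrict_of_subset hsub h2nonneg
  have hw := (hu₁.1.posPart_sub hpΩ₁ hΩ₁ hb₁ hG (hZ.mono hsub) h2nonneg₁).1
  have hV := hw.2.1.hasSobolevGrad
  obtain ⟨hw₂, hV₂⟩ := hw.extend hp hΩ₁ hΩ₂ hb₁ hsub hV
  have e1 := hu₁.2 _ hw
  have e2 := hu₂.2 _ hw₂
  -- The gradient of `w` on `Ω₂` is the zero extension of its gradient on `Ω₁`, so the second
  -- equation reduces to an integral over `Ω₁`.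
  rw [integral_flux_congr Filter.EventuallyEq.rfl (hV₂.weak.weakGrad_ae_eq hΩ₂)] at e2
  have hle : ∀ᵐ x ∂(MeasureTheory.volume.restrict Ω₁), u₁ x ≤ u₂ x := by
    refine hu₁.1.ae_le hN hpΩ₁ hΩ₁ hb₁ (fun x hx => hp1 x (hsub hx)) hG (hZ.mono hsub)
      h2nonneg₁ hV ?_
    -- Both flux integrals equal the value of `f` at the same function `w`, so the comparison
    -- hypothesis holds with equality.
    rw [e1, ← e2]
    refine ((MeasureTheory.setIntegral_eq_of_subset_of_forall_sdiff_eq_zero hΩ₂.measurableSet hsub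
      fun x hx => ?_).trans
      (MeasureTheory.setIntegral_congr_fun hΩ₁.measurableSet fun x hx => ?_)).le
    · rw [Set.indicator_of_notMem hx.2, inner_zero_right, mul_zero]
    · simp only [Set.indicator_of_mem hx]
  rw [MeasureTheory.ae_restrict_iff' hΩ₁.measurableSet] at hle
  rw [MeasureTheory.ae_restrict_iff' hΩ₂.measurableSet] at h2nonneg ⊢
  filter_upwards [hle, h2nonneg] with x h1 h2 hx
  by_cases hx₁ : x ∈ Ω₁
  · exact h1 hx₁
  · rw [hu₁.1.1 x hx₁]
    exact h2 hx
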